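/- Let $\mathfrak G_{2n}$ be the real Grassmann algebra with $2n$ anticommuting generators, and let $g=g_0+\mathbf g$ and $h=h_0+\mathbf h$ be elements of $C^\infty(\mathbb R^m)\otimes\mathfrak G_{2n}^{(ev)}$, with real valued bodies $g_0,h_0$ and nilpotent parts $\mathbf g,\mathbf h$. Assume that $\partial_{\underline x}[g_0]\neq 0$ on $g_0^{-1}(0)$ and that $h_0>0$ on $\mathbb R^m$. For such a $g$ let $\delta^{(j)}(g_0)$ be the pullback of the distribution $\delta^{(j)}$ by $g_0$ (the continuous extension of $v\mapsto v\circ g_0$ from smooth functions to distributions, on the open set where $\partial_{\underline x}[g_0]\ne0$, extended by zero away from $g_0^{-1}(0)$), let $H(g_0)$ be the function equal to $1$ where $g_0\ge 0$ and to $0$ where $g_0<0$, and define the superdistribution $$H(g)=H(g_0)+\sum_{j=1}^{n}\frac{\mathbf g^j}{j!}\,\delta^{(j-1)}(g_0)\in\mathcal D'(\mathbb R^m)\otimes\mathfrak G_{2n}.$$ Then $hg$ is even, $h_0g_0$ has non-vanishing gradient on its zero set, $\{h_0g_0<0\}=\{g_0<0\}$, the distributions $\delta^{(j)}(g_0)$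 and $\delta^{(j)}(h_0g_0)$ ($j\ge0$) exist and are unique, and $$H(hg)=H(g).$$ Consequently, if the closure $K$ of $\Omega_{m|0}=\{g_0<0\}$ is compact, the integral over the super-domain $\Omega_{m|2n}$ does not depend on the choice of the phase function: for every $F\in C^{n-1}(K)\otimes\mathfrak G_{2n}$ ($C^0(K)\otimes\mathfrak G_{2n}$ if $n=0$), $$\int_{\mathbb R^{m|2n}}H(-hg)\,F=\int_{\mathbb R^{m|2n}}H(-g)\,F ,$$ where $\int_{\mathbb R^{m|2n}}=\int_{\mathbb R^m}dV_{\underline x}\int_B$, $\int_B=\pi^{-n}\partial_{\theta_{2n}}\cdots\partial_{\theta_1}$ is the Berezin integral in the generators $\theta_1,\dots,\theta_{2n}$, and $H(-g)$ and $H(-hg)$ act on $F$ by continuity from test superfunctions with respect to $C^{n-1}(K)$-convergence; that is, a real number is the value of one side if and only if it is the value of the other. -/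

import Mathlib

open Set Filter Topology MeasureTheory TopologicalSpace
open scoped Distributions ContDiff TensorProduct

noncomputable section

namespace Superspace

/-! ### Superfunctions -/

/-- The bosonic space `ℝ^m`. -/
abbrev Space (m : ℕ) : Type := EuclideanSpace ℝ (Fin m)

/-- The algebra `C^∞(ℝ^m)` of real valued smooth functions. -/
def SmoothFun (m : ℕ) : Subalgebra ℝ (Space m → ℝ) where
  carrier := {f | ContDiff ℝ ∞ f}
  mul_mem' {f g} (hf : ContDiff ℝ ∞ f) (hg : ContDiff ℝ ∞ g) := (hf.mul hg : ContDiff ℝ ∞ (f * g))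
  add_mem' {f g} (hf : ContDiff ℝ ∞ f) (hg : ContDiff ℝ ∞ g) := (hf.add hg : ContDiff ℝ ∞ (f + g))
  algebraMap_mem' c := (contDiff_const : ContDiff ℝ ∞ fun _ : Space m => c)

/-- The Grassmann algebra `𝔊_{2n}` generated by `2n` anticommuting variables. -/
abbrev Grassmann (n : ℕ) : Type := ExteriorAlgebra ℝ (Fin (2 * n) → ℝ)

/-- The monomial `θ_A = θ_{j₁} ⋯ θ_{jₖ}` for `A = {j₁ < ⋯ < jₖ}`; these form a basis of the
Grassmann algebra. -/
def theta (n : ℕ) (A : Finset (Fin (2 * n))) : Grassmann n :=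
  (Pi.basisFun ℝ (Fin (2 * n))).ExteriorAlgebra A

/-- The subspace `𝔊_{2n}^{(ev)}` of even elements. -/
def evenGrassmann (n : ℕ) : Submodule ℝ (Grassmann n) :=
  CliffordAlgebra.evenOdd (0 : QuadraticForm ℝ (Fin (2 * n) → ℝ)) 0

/-- The algebra `C^∞(ℝ^m) ⊗ 𝔊_{2n}` of smooth superfunctions. -/
abbrev Superfun (m n : ℕ) : Type := SmoothFun m ⊗[ℝ] Grassmann n

/-- `F` belongs to `C^∞(ℝ^m) ⊗ 𝔊_{2n}^{(ev)}`. -/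
def IsEven {m n : ℕ} (F : Superfun m n) : Prop :=
  F ∈ LinearMap.range ((evenGrassmann n).subtype.lTensor (SmoothFun m))

/-- The body `F₀ = F_∅` of a superfunction. -/
def body {m n : ℕ} : Superfun m n →ₐ[ℝ] SmoothFun m :=
  (Algebra.TensorProduct.rid ℝ ℝ (SmoothFun m)).toAlgHom.comp
    (Algebra.TensorProduct.map (AlgHom.id ℝ (SmoothFun m)) ExteriorAlgebra.algebraMapInv)

/-- The nilpotent part `𝐅 = F - F₀` of a superfunction. -/
def nilp {m n : ℕ} (F : Superfun m n) : Superfun m n :=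
  F - body F ⊗ₜ[ℝ] (1 : Grassmann n)

/-- `g` is even and its body has nonvanishing gradient at each of its zeros. -/
structure IsPhase {m n : ℕ} (g : Superfun m n) : Prop where
  even : IsEven g
  regular : ∀ x : Space m, (body g : Space m → ℝ) x = 0 →
    fderiv ℝ (body g : Space m → ℝ) x ≠ 0

/-- The real domain `{x ∈ ℝ^m : g₀(x) < 0}` associated with `g`. -/
def realDomain {m n : ℕ} (g : Superfun m n) : Set (Space m) :=
  {x | (body g : Space m → ℝ) x < 0}

/-! ### Superdistributions -/

/-- Test functions `C_0^∞(ℝ^m)`. -/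
abbrev Test (m : ℕ) : Type := 𝓓((⊤ : Opens (Space m)), ℝ)

/-- Schwartz distributions on `ℝ^m`. -/
abbrev Distr (m : ℕ) : Type := 𝓓'((⊤ : Opens (Space m)), ℝ)

/-- Superdistributions `𝓓' ⊗ 𝔊_{2n}`. -/
abbrev Superdistr (m n : ℕ) : Type := Distr m ⊗[ℝ] Grassmann n

/-- Test superfunctions `C_0^∞(ℝ^m) ⊗ 𝔊_{2n}`. -/
abbrev Supertest (m n : ℕ) : Type := Test m ⊗[ℝ] Grassmann n

/-- The product `φ f` of a test function and a smooth function. -/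
def mulTest {m : ℕ} (f : SmoothFun m) (φ : Test m) : Test m where
  toFun x := φ x * (f : Space m → ℝ) x
  contDiff' := φ.contDiff.mul f.2
  hasCompactSupport' := φ.hasCompactSupport.mul_right
  tsupport_subset' := fun _ _ => trivial

/-- Multiplication of test functions by a fixed smooth function, as a continuous linear map. -/
def mulTestCLM {m : ℕ} (f : SmoothFun m) : Test m →L[ℝ] Test m :=
  TestFunction.limitCLM ℝ (mulTest f)
    (fun _ hK => (TestFunction.ofSupportedInCLM ℝ hK).comp
      (ContDiffMapSupportedIn.bilinLeftCLM (ContinuousLinearMap.mul ℝ ℝ) f.2))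
    (fun _ _ _ => rfl)

/-- The product `f T` of a smooth function and a distribution: `⟨f T, φ⟩ = ⟨T, φ f⟩`. -/
def smulDistr (m : ℕ) : SmoothFun m →ₗ[ℝ] Distr m →ₗ[ℝ] Distr m :=
  LinearMap.mk₂ ℝ
    (fun f T => ContinuousLinearMap.precompCompactConvergenceCLM ℝ (mulTestCLM f) T)
    (fun f₁ f₂ T => by
      ext φ
      change T (mulTest (f₁ + f₂) φ) = T (mulTest f₁ φ) + T (mulTest f₂ φ)
      rw [← map_add]
      congr 1
      ext x
      exact mul_add _ _ _)
    (fun c f T => by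
      ext φ
      change T (mulTest (c • f) φ) = c • T (mulTest f φ)
      rw [← map_smul]
      congr 1
      ext x
      exact mul_left_comm _ _ _)
    (fun f T₁ T₂ => map_add _ T₁ T₂)
    (fun c f T => map_smul _ c T)

/-- The product of a superfunction and a superdistribution:
`(f ⊗ a) (T ⊗ b) = (f T) ⊗ (a b)`. -/
def superMul (m n : ℕ) : Superfun m n →ₗ[ℝ] Superdistr m n →ₗ[ℝ] Superdistr m n :=
  TensorProduct.map₂ (smulDistr m) (LinearMap.mul ℝ (Grassmann n))

/-- The fermionic derivative `∂_{θ_j}`: the antiderivation of the Grassmann algebra with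
`∂_{θ_j} θ_k = δ_{jk}`. -/
def fermionDeriv {n : ℕ} (j : Fin (2 * n)) : Grassmann n →ₗ[ℝ] Grassmann n :=
  CliffordAlgebra.contractLeft (Q := (0 : QuadraticForm ℝ (Fin (2 * n) → ℝ)))
    (LinearMap.proj (R := ℝ) (φ := fun _ : Fin (2 * n) => ℝ) j)

/-- The Berezin integral `π^{-n} ∂_{θ_{2n}} ⋯ ∂_{θ_1}` (the derivative by the first variable acts
first; the result is a scalar). -/
def berezin (n : ℕ) : Grassmann n →ₗ[ℝ] ℝ :=
  ((Real.pi ^ n)⁻¹ : ℝ) • (ExteriorAlgebra.algebraMapInv.toLinearMap ∘ₗ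
    (List.finRange (2 * n)).foldl (fun D j => fermionDeriv j ∘ₗ D) LinearMap.id)

/-- The evaluation `⟨T, φ⟩`. -/
def evalDistr (m : ℕ) : Distr m →ₗ[ℝ] Test m →ₗ[ℝ] ℝ :=
  LinearMap.mk₂ ℝ (fun T φ => T φ)
    (fun _ _ _ => rfl) (fun _ _ _ => rfl)
    (fun T φ₁ φ₂ => map_add T φ₁ φ₂) (fun c T φ => map_smul T c φ)

/-- The integral `∫_{ℝ^{m|2n}} α F`, given by
`∫ (T ⊗ a) (φ ⊗ b) = ⟨T, φ⟩ ∫_B a b`. -/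
def superIntegral (m n : ℕ) : Superdistr m n →ₗ[ℝ] Supertest m n →ₗ[ℝ] ℝ :=
  (TensorProduct.map₂ (evalDistr m) (LinearMap.mul ℝ (Grassmann n))).compr₂
    (berezin n ∘ₗ (TensorProduct.lid ℝ (Grassmann n)).toLinearMap)

/-! ### Dirac and Heaviside distributions of a phase function -/

/-- The sequence `v` of functions converges to the derivative `δ^{(k)}` of the Dirac distribution
in the sense of distributions on `ℝ`. -/
def TendstoDirac (k : ℕ) (v : ℕ → ℝ → ℝ) : Prop :=
  ∀ ψ : 𝓓((⊤ : Opens ℝ), ℝ),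
    Tendsto (fun i => ∫ t, v i t * ψ t) atTop (𝓝 ((-1) ^ k * iteratedDeriv k ψ 0))

/-- `T` is the composition `δ^{(k)}(g₀)` on `ℝ^m`: on the open set where `g₀` is a submersion it is
the pullback of `δ^{(k)}` by `g₀`, that is the distributional limit of `vᵢ ∘ g₀` for all smooth
`vᵢ → δ^{(k)}` (extension of the composition by continuity), and it vanishes away from
`g₀⁻¹(0)`. -/
structure IsDiracComp {m : ℕ} (k : ℕ) (g₀ : Space m → ℝ) (T : Distr m) : Prop where
  tendsto : ∀ v : ℕ → ℝ → ℝ, (∀ i, ContDiff ℝ ∞ (v i)) → TendstoDirac k v →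
    ∀ φ : Test m, (∀ x ∈ tsupport φ, fderiv ℝ g₀ x ≠ 0) →
      Tendsto (fun i => ∫ x, v i (g₀ x) * φ x) atTop (𝓝 (T φ))
  eq_zero : ∀ φ : Test m, (∀ x ∈ tsupport φ, g₀ x ≠ 0) → T φ = 0

open Classical in
/-- The distribution `δ^{(k)}(g₀)` (zero by convention if it is not defined). -/
def diracComp {m : ℕ} (k : ℕ) (g₀ : Space m → ℝ) : Distr m :=
  if h : ∃ T, IsDiracComp k g₀ T then h.choose else 0

/-- The distribution `H(g₀)`, given by the function with value `1` where `g₀ ≥ 0` and `0` where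
`g₀ < 0`. -/
def heavisideComp {m : ℕ} (g₀ : Space m → ℝ) : Distr m :=
  let L : Test m →L[ℝ] ℝ := TestFunction.integralAgainstBilinCLM (ContinuousLinearMap.mul ℝ ℝ) volume
    ({x | 0 ≤ g₀ x}.indicator 1)
  { toFun := L, map_add' := map_add L, map_smul' := map_smul L, cont := L.continuous }

/-- The Heaviside superdistribution
`H(g) = H(g₀) + ∑_{j=1}^n (𝐠^j / j!) δ^{(j-1)}(g₀)`. -/
def heaviside {m n : ℕ} (g : Superfun m n) : Superdistr m n :=
  heavisideComp (body g : Space m → ℝ) ⊗ₜ[ℝ] (1 : Grassmann n) +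
    ∑ j ∈ Finset.Icc 1 n, ((j.factorial : ℝ)⁻¹) •
      superMul m n (nilp g ^ j)
        (diracComp (j - 1) (body g : Space m → ℝ) ⊗ₜ[ℝ] (1 : Grassmann n))

/-! ### Domain integrals -/

/-- The test superfunction `∑_A φ_A θ_A`. -/
def toSupertest {m n : ℕ} (φ : Finset (Fin (2 * n)) → Test m) : Supertest m n :=
  ∑ A, φ A ⊗ₜ[ℝ] theta n A

/-- The sequence `φ` converges to `f` in `C^k(K)`: all derivatives up to order `k` converge
uniformly on `K`. -/
def TendstoCk {m : ℕ} (k : ℕ) (K : Set (Space m)) (φ : ℕ → Test m) (f : Space m → ℝ) : Prop :=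
  ∀ j ≤ k, TendstoUniformlyOn (fun i => iteratedFDeriv ℝ j (φ i))
    (iteratedFDerivWithin ℝ j f K) atTop K

/-- `c` is the value of the superdomain integral `∫_{ℝ^{m|2n}} H(-g) F` at the superfunction
`F = ∑_A F_A θ_A` with coefficients in `C^{n-1}` on the closure `K` of the real domain of `g`,
the functional being extended from test superfunctions by continuity with respect to the
convergence in `C^{n-1}(K)` (in `C^0(K)` if `n = 0`). -/
def HasDomainIntegral {m n : ℕ} (g : Superfun m n) (F : Finset (Fin (2 * n)) → Space m → ℝ)
    (c : ℝ) : Prop :=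
  ∀ φ : ℕ → Finset (Fin (2 * n)) → Test m,
    (∀ A, TendstoCk (n - 1) (closure (realDomain g)) (fun i => φ i A) (F A)) →
      Tendsto (fun i => superIntegral m n (heaviside (-g)) (toSupertest (φ i))) atTop (𝓝 c)

end Superspace

end

open Superspace

/-!
# The Heaviside superdistribution of a phase function is invariant under rescaling

**Distributions `δ^{(k)}(u)`.** Let `u` be a smooth function on `ℝ^m` and `X` a smooth vector field
with `X u = 1` on the support of a test function `φ`. Such a field exists as soon as `u` has no
critical points there (`exists_dirDeriv_eq_one`). Integration by parts along `X` and Fubini show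
that the image of the signed measure `φ dx` under `u` has the density `t ↦ ∫_{t ≤ u} X^* φ`, where
`X^*` is the formal adjoint of `X`; minus its derivative is the density obtained from `X^* φ`. So
this density is a test function `ψ` on `ℝ`, with `(-1)^k ψ^{(k)}(0) = ∫_{0 ≤ u} (X^*)^{k+1} φ`
(`exists_isLevelDensity_of_dirDeriv_eq_one`). If `v_i → δ^{(k)}`, then
`∫ v_i(u) φ = ∫ v_i ψ → (-1)^k ψ^{(k)}(0)`, and the integral formula for the limit is continuous in
`φ`. With a cutoff near the zeros of `u` this gives existence and uniqueness of `δ^{(k)}(u)`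
(`exists_isDiracComp`, `IsDiracComp.unique`). No change of variables is needed.

**Calculus.** Write `E_0 = H(u)` and `E_{j+1} = δ^{(j)}(u)`. The level densities give the relations
`u E_{j+1} = -j E_j` and `(Y u) E_{j+1} = Y E_j` for every vector field `Y`. Applied with a field
such that `Y (h u) = 1`, they give by induction the homogeneity `h^j E_j(h u) = E_j(u)` for a
positive function `h` (`heavisideDerivComp_mul_apply`).

**Algebra.** Even superfunctions are central, and their nilpotent parts have vanishing `(n+1)`-st
power. With `η = 𝐡 / h₀`, the nilpotent part of `h g` is `h₀ ((1 + η) 𝐠 + η g₀)`. By homogeneity the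
powers of `h₀` cancel in `H(h g)`, and there remains the identity
`∑_{j ≥ 1} ((1 + η) 𝐠 + η g₀)^j / j! δ^{(j-1)}(g₀) = ∑_{j ≥ 1} 𝐠^j / j! δ^{(j-1)}(g₀)`
(`sum_pow_act_eq`). It is the shadow of
`log ((1 + η) (1 + 𝐠 / g₀)) = log (1 + 𝐠 / g₀)` modulo terms regular in `g₀`, and it follows from the
relation `g₀ δ^{(k+1)}(g₀) = -(k+1) δ^{(k)}(g₀)` and the negative binomial series.

Since `-(h g) = h (-g)`, the invariance applied to `-g` shows that the functionals defining the two
domain integrals coincide.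
-/

noncomputable section

namespace Superspace

/-! ### Vector fields acting on smooth functions and on test functions -/

/-- The partial derivative `∂_i f`. -/
def partialDeriv {m : ℕ} (i : Fin m) (f : SmoothFun m) : SmoothFun m :=
  ⟨fun x => fderiv ℝ (f : Space m → ℝ) x (EuclideanSpace.single i 1),
    (((show ContDiff ℝ ∞ (f : Space m → ℝ) from f.2).fderiv_right (m := ∞) (by simp)).clm_apply
      contDiff_const : ContDiff ℝ ∞ _)⟩

/-- The derivative `X f = ∑_i X_i ∂_i f` along the smooth vector field `X` on `ℝ^m`, which is
given by its coordinates. -/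
def dirDeriv {m : ℕ} (X : Fin m → SmoothFun m) (f : SmoothFun m) : SmoothFun m :=
  ∑ i, X i * partialDeriv i f

/-- The formal adjoint `φ ↦ -∑_i ∂_i (X_i φ)` of the derivative along the vector field `X`. -/
def dirAdjoint {m : ℕ} (X : Fin m → SmoothFun m) : Test m →L[ℝ] Test m :=
  -∑ i, (TestFunction.lineDerivCLM ℝ (EuclideanSpace.single i (1 : ℝ))).comp (mulTestCLM (X i))

theorem contDiff_coe {m : ℕ} (f : SmoothFun m) : ContDiff ℝ ∞ (f : Space m → ℝ) := f.2

theorem differentiable_coe {m : ℕ} (f : SmoothFun m) :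
    Differentiable ℝ (f : Space m → ℝ) := (contDiff_coe f).differentiable (by simp)

theorem continuous_coe {m : ℕ} (f : SmoothFun m) : Continuous (f : Space m → ℝ) :=
  (contDiff_coe f).continuous

theorem dirDeriv_apply {m : ℕ} (X : Fin m → SmoothFun m) (f : SmoothFun m) (x : Space m) :
    (dirDeriv X f : Space m → ℝ) x = ∑ i, (X i : Space m → ℝ) x *
      fderiv ℝ (f : Space m → ℝ) x (EuclideanSpace.single i 1) := by
  simp [dirDeriv, partialDeriv]

theorem mulTest_apply {m : ℕ} (f : SmoothFun m) (φ : Test m) (x : Space m) :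
    mulTest f φ x = φ x * (f : Space m → ℝ) x := rfl

theorem dirAdjoint_apply {m : ℕ} (X : Fin m → SmoothFun m) (φ : Test m) (x : Space m) :
    dirAdjoint X φ x = -∑ i, fderiv ℝ (mulTest (X i) φ) x (EuclideanSpace.single i 1) := by
  have key : ∀ i, (TestFunction.lineDerivCLM ℝ (EuclideanSpace.single i (1 : ℝ))
      (mulTest (X i) φ) : Test m) x
      = fderiv ℝ (mulTest (X i) φ) x (EuclideanSpace.single i 1) := by
    intro i
    rw [TestFunction.lineDerivCLM_eq_fderivCLM, TestFunction.fderivCLM_apply_of_le]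
    simp
  have : dirAdjoint X φ = -∑ i, TestFunction.lineDerivCLM ℝ (EuclideanSpace.single i (1 : ℝ))
      (mulTest (X i) φ) := by
    simp only [dirAdjoint, neg_apply, sum_apply]
    rfl
  rw [this, neg_apply, sum_apply]
  simp only [key]

theorem tsupport_mulTest_subset {m : ℕ} (f : SmoothFun m) (φ : Test m) :
    tsupport (mulTest f φ) ⊆ tsupport φ :=
  tsupport_mul_subset_left (f := φ) (g := (f : Space m → ℝ))

theorem tsupport_dirAdjoint_subset {m : ℕ} (X : Fin m → SmoothFun m) (φ : Test m) :
    tsupport (dirAdjoint X φ) ⊆ tsupport φ := by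
  refine closure_minimal (fun x hx => ?_) (isClosed_tsupport _)
  by_contra hx'
  refine hx ?_
  rw [dirAdjoint_apply, neg_eq_zero]
  refine Finset.sum_eq_zero fun i _ => ?_
  rw [fderiv_of_notMem_tsupport ℝ fun h => hx' (tsupport_mulTest_subset _ _ h)]
  rfl

theorem integrable_mul_test {m : ℕ} {f : Space m → ℝ} (hf : Continuous f) (φ : Test m) :
    Integrable fun x => f x * φ x :=
  (hf.mul φ.continuous).integrable_of_hasCompactSupport φ.hasCompactSupport.mul_left

theorem test_integrable {m : ℕ} (φ : Test m) : Integrable φ :=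
  φ.continuous.integrable_of_hasCompactSupport φ.hasCompactSupport

/-- Integration by parts against the chain rule: the derivative of `V ∘ u` along `X` is
`(V' ∘ u) (X u)`. -/
theorem integral_comp_mul_dirDeriv {m : ℕ} (X : Fin m → SmoothFun m) (u : SmoothFun m)
    (φ : Test m) {V v : ℝ → ℝ} (hV : ∀ t, HasDerivAt V (v t) t) (hv : Continuous v) :
    ∫ x, v ((u : Space m → ℝ) x) * mulTest (dirDeriv X u) φ x
      = ∫ x, V ((u : Space m → ℝ) x) * dirAdjoint X φ x := by
  have hVc : Continuous V := continuous_iff_continuousAt.2 fun t => (hV t).continuousAt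
  set F : Space m → ℝ := fun x => V ((u : Space m → ℝ) x) with hF
  have hF' : ∀ x, HasFDerivAt F (v ((u : Space m → ℝ) x) • fderiv ℝ (u : Space m → ℝ) x) x :=
    fun x => (hV _).comp_hasFDerivAt x ((differentiable_coe u) x).hasFDerivAt
  have hFc : Continuous F := hVc.comp (continuous_coe u)
  have hvc : Continuous fun x => v ((u : Space m → ℝ) x) := hv.comp (continuous_coe u)
  let e : Fin m → Space m := fun i => EuclideanSpace.single i 1
  let ψ : Fin m → Test m := fun i => mulTest (X i) φ
  let dψ : Fin m → Test m := fun i => TestFunction.lineDerivCLM ℝ (e i) (ψ i)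
  have hdψ : ∀ i x, dψ i x = fderiv ℝ (ψ i) x (e i) := by
    intro i x
    simp only [dψ]
    rw [TestFunction.lineDerivCLM_eq_fderivCLM, TestFunction.fderivCLM_apply_of_le]
    simp
  have hfd : ∀ i x, fderiv ℝ F x (e i)
      = v ((u : Space m → ℝ) x) * (partialDeriv i u : Space m → ℝ) x := by
    intro i x
    rw [(hF' x).fderiv]
    simp [partialDeriv, e]
  have hint1 : ∀ i, Integrable fun x => fderiv ℝ F x (e i) * ψ i x := by
    intro i
    simp only [hfd]
    exact integrable_mul_test (hvc.mul (continuous_coe (partialDeriv i u))) (ψ i)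
  have hint2 : ∀ i, Integrable fun x => F x * fderiv ℝ (ψ i) x (e i) := by
    intro i
    simp only [← hdψ]
    exact integrable_mul_test hFc _
  have ibp : ∀ i, ∫ x, F x * fderiv ℝ (ψ i) x (e i) = -∫ x, fderiv ℝ F x (e i) * ψ i x :=
    fun i => integral_mul_fderiv_eq_neg_fderiv_mul_of_integrable (hint1 i) (hint2 i)
      (integrable_mul_test hFc (ψ i)) (fun x _ => (hF' x).differentiableAt)
      (fun x _ => (ψ i).contDiff.differentiable (by simp) x)
  have h1 : ∀ x, v ((u : Space m → ℝ) x) * mulTest (dirDeriv X u) φ x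
      = ∑ i, fderiv ℝ F x (e i) * ψ i x := by
    intro x
    rw [mulTest_apply, dirDeriv_apply, Finset.mul_sum, Finset.mul_sum]
    refine Finset.sum_congr rfl fun i _ => ?_
    rw [hfd]
    simp only [ψ, mulTest_apply, partialDeriv]
    ring
  have h2 : ∀ x, F x * dirAdjoint X φ x = -∑ i, F x * fderiv ℝ (ψ i) x (e i) := by
    intro x
    rw [dirAdjoint_apply, mul_neg, Finset.mul_sum]
  change _ = ∫ x, F x * dirAdjoint X φ x
  simp only [h1, h2]
  rw [integral_finsetSum _ fun i _ => hint1 i, integral_neg,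
    integral_finsetSum _ fun i _ => hint2 i, ← Finset.sum_neg_distrib]
  exact Finset.sum_congr rfl fun i _ => by rw [ibp, neg_neg]

theorem dirDeriv_mul {m : ℕ} (X : Fin m → SmoothFun m) (f g : SmoothFun m) :
    dirDeriv X (f * g) = f * dirDeriv X g + g * dirDeriv X f := by
  ext x
  change (dirDeriv X (f * g) : Space m → ℝ) x = (f : Space m → ℝ) x * (dirDeriv X g : Space m → ℝ) x
    + (g : Space m → ℝ) x * (dirDeriv X f : Space m → ℝ) x
  simp only [dirDeriv_apply, Finset.mul_sum, ← Finset.sum_add_distrib]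
  refine Finset.sum_congr rfl fun i _ => ?_
  have : ((f * g : SmoothFun m) : Space m → ℝ) = (f : Space m → ℝ) * (g : Space m → ℝ) := rfl
  rw [this, fderiv_mul ((differentiable_coe f) x) ((differentiable_coe g) x)]
  simp
  ring

theorem dirAdjoint_mulTest {m : ℕ} (X : Fin m → SmoothFun m) (f : SmoothFun m) (φ : Test m) :
    dirAdjoint X (mulTest f φ) = mulTest f (dirAdjoint X φ) - mulTest (dirDeriv X f) φ := by
  ext x
  rw [sub_apply, mulTest_apply, mulTest_apply, dirAdjoint_apply, dirAdjoint_apply,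
    dirDeriv_apply, neg_mul, Finset.sum_mul, Finset.mul_sum, ← neg_add', ← Finset.sum_add_distrib]
  congr 1
  refine Finset.sum_congr rfl fun i _ => ?_
  have : (mulTest (X i) (mulTest f φ) : Space m → ℝ)
      = (mulTest (X i) φ : Space m → ℝ) * (f : Space m → ℝ) := by
    funext y
    simp only [Pi.mul_apply, mulTest_apply]
    ring
  rw [this, fderiv_mul ((mulTest (X i) φ).contDiff.differentiable (by simp) x)
    ((differentiable_coe f) x)]
  simp [mulTest_apply]
  ring

theorem exists_smooth_zero_one {m : ℕ} {s t : Set (Space m)} (hs : IsClosed s) (ht : IsClosed t)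
    (hst : Disjoint s t) : ∃ f : SmoothFun m, (∀ x, 0 ≤ (f : Space m → ℝ) x) ∧
      (∀ᶠ x in 𝓝ˢ s, (f : Space m → ℝ) x = 0) ∧ (∀ᶠ x in 𝓝ˢ t, (f : Space m → ℝ) x = 1) := by
  obtain ⟨f, h0, h1, h⟩ := exists_contMDiffMap_zero_one_nhds_of_isClosed
    (modelWithCornersSelf ℝ (Space m)) (n := ⊤) hs ht hst
  exact ⟨⟨f, f.contMDiff.contDiff⟩, fun x => (h x).1, h0, h1⟩

theorem isClosed_fderiv_eq_zero {m : ℕ} (u : SmoothFun m) :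
    IsClosed {x : Space m | fderiv ℝ (u : Space m → ℝ) x = 0} :=
  isClosed_eq ((contDiff_coe u).continuous_fderiv (by simp)) continuous_const

/-- On a closed set without critical points of `u`, the field `X = ∇u / (|∇u|² + ρ)`, with `ρ`
vanishing there and positive at the critical points, satisfies `X u = 1`. -/
theorem exists_dirDeriv_eq_one {m : ℕ} (u : SmoothFun m) {C : Set (Space m)} (hC : IsClosed C)
    (hu : ∀ x ∈ C, fderiv ℝ (u : Space m → ℝ) x ≠ 0) :
    ∃ X : Fin m → SmoothFun m, ∀ x ∈ C, (dirDeriv X u : Space m → ℝ) x = 1 := by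
  obtain ⟨ρ, hρ, hρ0, hρ1⟩ := exists_smooth_zero_one hC (isClosed_fderiv_eq_zero u)
    (Set.disjoint_left.2 fun x hx h => hu x hx h)
  let N : SmoothFun m := ∑ i, partialDeriv i u * partialDeriv i u
  have hN : ∀ x, (N : Space m → ℝ) x = ∑ i, (partialDeriv i u : Space m → ℝ) x *
      (partialDeriv i u : Space m → ℝ) x := by
    intro x
    simp [N]
  have hNnn : ∀ x, 0 ≤ (N : Space m → ℝ) x := fun x => by
    rw [hN]; exact Finset.sum_nonneg fun i _ => mul_self_nonneg _
  have hNpos : ∀ x, fderiv ℝ (u : Space m → ℝ) x ≠ 0 → 0 < (N : Space m → ℝ) x := by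
    intro x hx
    refine lt_of_le_of_ne (hNnn x) fun h => hx ?_
    rw [hN, eq_comm, Finset.sum_eq_zero_iff_of_nonneg fun i _ => mul_self_nonneg _] at h
    have h' : ((fderiv ℝ (u : Space m → ℝ) x : Space m →L[ℝ] ℝ) : Space m →ₗ[ℝ] ℝ) = 0 := by
      refine (EuclideanSpace.basisFun (Fin m) ℝ).toBasis.ext fun i => ?_
      simpa [partialDeriv] using h i (Finset.mem_univ i)
    exact ContinuousLinearMap.coe_injective h'
  have hpos : ∀ x, (N : Space m → ℝ) x + (ρ : Space m → ℝ) x ≠ 0 := by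
    intro x
    by_cases hx : fderiv ℝ (u : Space m → ℝ) x = 0
    · have h1 : (ρ : Space m → ℝ) x = 1 := hρ1.self_of_nhdsSet x hx
      have := hNnn x
      linarith
    · have := hNpos x hx
      have := hρ x
      linarith
  let I : SmoothFun m := ⟨fun x => ((N : Space m → ℝ) x + (ρ : Space m → ℝ) x)⁻¹,
    ((contDiff_coe N).add (contDiff_coe ρ)).inv hpos⟩
  refine ⟨fun i => partialDeriv i u * I, fun x hx => ?_⟩
  have h0 : (ρ : Space m → ℝ) x = 0 := hρ0.self_of_nhdsSet x hx
  have h1 : (dirDeriv (fun i => partialDeriv i u * I) u : Space m → ℝ) x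
      = (N : Space m → ℝ) x * ((N : Space m → ℝ) x + (ρ : Space m → ℝ) x)⁻¹ := by
    rw [dirDeriv_apply, hN, Finset.sum_mul]
    refine Finset.sum_congr rfl fun i _ => ?_
    simp [partialDeriv, I, hN]
    ring
  rw [h1, h0, add_zero, mul_inv_cancel₀ (hNpos x (hu x hx)).ne']

/-! ### Level densities -/

/-- `ψ` is the density of the push-forward of the signed measure `φ dx` by `u`. -/
def IsLevelDensity {m : ℕ} (u : SmoothFun m) (φ : Test m) (ψ : ℝ → ℝ) : Prop :=
  ∀ v : ℝ → ℝ, Continuous v → ∫ x, v ((u : Space m → ℝ) x) * φ x = ∫ t, v t * ψ t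

/-- A level density computes the integral of `φ` over `{s ≤ u}`, by approximation of the indicator
of `[s, ∞)` with continuous functions. -/
theorem IsLevelDensity.integral_indicator {m : ℕ} {u : SmoothFun m} {φ : Test m} {ψ : ℝ → ℝ}
    (h : IsLevelDensity u φ ψ) (hψ : Integrable ψ) (s : ℝ) :
    ∫ x, {x | s ≤ (u : Space m → ℝ) x}.indicator φ x = ∫ t in Ici s, ψ t := by
  let v : ℕ → ℝ → ℝ := fun n t => max 0 (min 1 (1 + n * (t - s)))
  have hvc : ∀ n, Continuous (v n) := fun n => by fun_prop
  have hv1 : ∀ n t, ‖v n t‖ ≤ 1 := by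
    intro n t
    rw [Real.norm_eq_abs, abs_le]
    exact ⟨by linarith [le_max_left 0 (min 1 (1 + (n : ℝ) * (t - s)))],
      max_le zero_le_one (min_le_left _ _)⟩
  have hvlim : ∀ t, Tendsto (fun n => v n t) atTop (𝓝 ((Ici s).indicator 1 t)) := by
    intro t
    by_cases ht : s ≤ t
    · rw [indicator_of_mem (show t ∈ Ici s from ht)]
      refine tendsto_const_nhds.congr fun n => ?_
      have : 0 ≤ (n : ℝ) * (t - s) := mul_nonneg n.cast_nonneg (by linarith)
      simp only [v, Pi.one_apply]
      rw [min_eq_left (by linarith), max_eq_right zero_le_one]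
    · rw [indicator_of_notMem (show t ∉ Ici s from ht)]
      have hlim : Tendsto (fun n : ℕ => 1 + (n : ℝ) * (t - s)) atTop atBot :=
        tendsto_atBot_add_const_left _ _
          (tendsto_natCast_atTop_atTop.atTop_mul_const_of_neg (by linarith))
      refine tendsto_const_nhds.congr' ?_
      filter_upwards [hlim.eventually_le_atBot 0] with n hn
      simp only [v]
      rw [max_eq_left ((min_le_right _ _).trans hn)]
  have hL : Tendsto (fun n => ∫ x, v n ((u : Space m → ℝ) x) * φ x) atTop
      (𝓝 (∫ x, (Ici s).indicator 1 ((u : Space m → ℝ) x) * φ x)) := by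
    refine tendsto_integral_of_dominated_convergence (fun x => ‖φ x‖)
      (fun n => (((hvc n).comp (continuous_coe u)).mul φ.continuous).aestronglyMeasurable)
      (test_integrable φ).norm (fun n => ae_of_all _ fun x => ?_)
      (ae_of_all _ fun x => (hvlim _).mul_const _)
    rw [norm_mul]
    exact mul_le_of_le_one_left (norm_nonneg _) (hv1 _ _)
  have hR : Tendsto (fun n => ∫ t, v n t * ψ t) atTop
      (𝓝 (∫ t, (Ici s).indicator 1 t * ψ t)) := by
    refine tendsto_integral_of_dominated_convergence (fun t => ‖ψ t‖)
      (fun n => (hvc n).aestronglyMeasurable.mul hψ.aestronglyMeasurable)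
      hψ.norm (fun n => ae_of_all _ fun x => ?_)
      (ae_of_all _ fun x => (hvlim _).mul_const _)
    rw [norm_mul]
    exact mul_le_of_le_one_left (norm_nonneg _) (hv1 _ _)
  have := tendsto_nhds_unique hL (hR.congr fun n => (h (v n) (hvc n)).symm)
  rw [← MeasureTheory.integral_indicator measurableSet_Ici]
  convert this using 2
  · funext x
    by_cases hx : s ≤ (u : Space m → ℝ) x <;> simp [indicator, hx]
  · funext x
    by_cases hx : s ≤ x <;> simp [indicator, hx]

/-- The function `t ↦ ∫_{t ≤ u} φ`. -/
def superlevelIntegral {m : ℕ} (u : SmoothFun m) (φ : Test m) (t : ℝ) : ℝ :=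
  ∫ x, {x | t ≤ (u : Space m → ℝ) x}.indicator φ x

theorem exists_bounds_on_tsupport {m : ℕ} (u : SmoothFun m) (φ : Test m) :
    ∃ a b : ℝ, a < b ∧ ∀ x ∈ tsupport φ, a < (u : Space m → ℝ) x ∧ (u : Space m → ℝ) x < b := by
  have hK : IsCompact ((u : Space m → ℝ) '' tsupport φ) :=
    IsCompact.image φ.hasCompactSupport (continuous_coe u)
  obtain ⟨a, ha⟩ := hK.bddBelow
  obtain ⟨b, hb⟩ := hK.bddAbove
  refine ⟨min a b - 1, max a b + 1, by linarith [min_le_max (a := a) (b := b)], fun x hx => ?_⟩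
  have h1 := ha (mem_image_of_mem _ hx)
  have h2 := hb (mem_image_of_mem _ hx)
  exact ⟨by linarith [min_le_left a b], by linarith [le_max_right a b]⟩

theorem superlevelIntegral_eq_zero {m : ℕ} {u : SmoothFun m} {φ : Test m} {t : ℝ}
    (h : ∀ x ∈ tsupport φ, (u : Space m → ℝ) x < t) : superlevelIntegral u φ t = 0 := by
  refine integral_eq_zero_of_ae (ae_of_all _ fun x => ?_)
  by_cases hx : x ∈ tsupport φ
  · rw [indicator_of_notMem (by simpa using h x hx)]
    rfl
  · rw [indicator_apply_eq_zero.2 fun _ => image_eq_zero_of_notMem_tsupport hx]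
    rfl

theorem superlevelIntegral_eq_integral {m : ℕ} {u : SmoothFun m} {φ : Test m} {t : ℝ}
    (h : ∀ x ∈ tsupport φ, t ≤ (u : Space m → ℝ) x) :
    superlevelIntegral u φ t = ∫ x, φ x := by
  refine integral_congr_ae (ae_of_all _ fun x => ?_)
  by_cases hx : x ∈ tsupport φ
  · exact indicator_of_mem (s := {x | t ≤ (u : Space m → ℝ) x}) (h x hx) _
  · have h0 := image_eq_zero_of_notMem_tsupport hx
    simp [indicator, h0]

theorem integral_dirAdjoint {m : ℕ} (X : Fin m → SmoothFun m) (φ : Test m) :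
    ∫ x, dirAdjoint X φ x = 0 := by
  have := integral_comp_mul_dirDeriv X 0 φ (V := fun _ => 1) (v := fun _ => 0)
    (fun t => hasDerivAt_const t 1) continuous_const
  simpa using this.symm

section UnitSpeed

variable {m : ℕ} {X : Fin m → SmoothFun m} {u : SmoothFun m}

theorem mulTest_eq_self {φ : Test m} {f : SmoothFun m}
    (h : ∀ x ∈ tsupport φ, (f : Space m → ℝ) x = 1) : mulTest f φ = φ := by
  ext x
  rw [mulTest_apply]
  by_cases hx : x ∈ tsupport φ
  · rw [h x hx, mul_one]
  · rw [image_eq_zero_of_notMem_tsupport hx, zero_mul]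

theorem superlevelIntegral_dirAdjoint_eq_zero {φ : Test m} {a b t : ℝ}
    (hab : ∀ x ∈ tsupport φ, a < (u : Space m → ℝ) x ∧ (u : Space m → ℝ) x < b)
    (ht : t ∉ Ioc a b) : superlevelIntegral u (dirAdjoint X φ) t = 0 := by
  rcases le_or_gt t a with hta | hta
  · rw [superlevelIntegral_eq_integral, integral_dirAdjoint]
    exact fun x hx => (hta.trans_lt (hab x (tsupport_dirAdjoint_subset X φ hx)).1).le
  · have htb : b < t := not_le.1 fun h => ht ⟨hta, h⟩
    exact superlevelIntegral_eq_zero fun x hx =>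
      (hab x (tsupport_dirAdjoint_subset X φ hx)).2.trans htb

theorem integrable_indicator_prod (φ : Test m) {v : ℝ → ℝ} (hv : Continuous v) (a b : ℝ) :
    Integrable (Function.uncurry fun (x : Space m) (t : ℝ) =>
      {y | t ≤ (u : Space m → ℝ) y}.indicator φ x * v t)
      (volume.prod (volume.restrict (Ioc a b))) := by
  have h1 : Integrable (fun z : Space m × ℝ => φ z.1 * v z.2)
      (volume.prod (volume.restrict (Ioc a b))) :=
    (test_integrable φ).mul_prod
      ((hv.integrableOn_Icc (a := a) (b := b)).mono_set Ioc_subset_Icc_self)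
  have h2 : MeasurableSet {z : Space m × ℝ | z.2 ≤ (u : Space m → ℝ) z.1} :=
    measurableSet_le measurable_snd ((continuous_coe u).measurable.comp measurable_fst)
  refine (h1.indicator h2).congr (ae_of_all _ fun z => ?_)
  by_cases hz : z.2 ≤ (u : Space m → ℝ) z.1 <;> simp [indicator, hz, Function.uncurry]

theorem integrable_superlevelIntegral (φ : Test m) :
    Integrable (superlevelIntegral u (dirAdjoint X φ)) := by
  obtain ⟨a, b, -, hab⟩ := exists_bounds_on_tsupport u φ
  have h := (integrable_indicator_prod (u := u) (dirAdjoint X φ)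
    (continuous_const (y := (1 : ℝ))) a b).integral_prod_right
  refine (integrableOn_iff_integrable_of_support_subset (s := Ioc a b) fun t ht => ?_).1 ?_
  · by_contra h'
    exact ht (superlevelIntegral_dirAdjoint_eq_zero hab h')
  · refine h.congr (ae_of_all _ fun t => ?_)
    simp [superlevelIntegral, Function.uncurry]

/-- Integration by parts along `X` and Fubini show that `t ↦ ∫_{t ≤ u} X^* φ` is the level density
of `(X u) φ`. -/
theorem isLevelDensity_superlevelIntegral (X : Fin m → SmoothFun m) (u : SmoothFun m)
    (φ : Test m) : IsLevelDensity u (mulTest (dirDeriv X u) φ)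
      (superlevelIntegral u (dirAdjoint X φ)) := by
  intro v hv
  obtain ⟨a, b, hlt, hab⟩ := exists_bounds_on_tsupport u φ
  have hV : ∀ t, HasDerivAt (fun s => ∫ r in a..s, v r) (v t) t :=
    fun t => (hv.integral_hasStrictDerivAt a t).hasDerivAt
  have h1 := integral_comp_mul_dirDeriv X u φ hV hv
  have h2 : ∀ x, (∫ r in a..(u : Space m → ℝ) x, v r) * dirAdjoint X φ x =
      ∫ t in Ioc a b, {y | t ≤ (u : Space m → ℝ) y}.indicator (dirAdjoint X φ) x * v t := by
    intro x
    by_cases hx : x ∈ tsupport φ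
    · obtain ⟨hxa, hxb⟩ := hab x hx
      rw [intervalIntegral.integral_of_le hxa.le, mul_comm, ← integral_const_mul,
        ← integral_indicator measurableSet_Ioc, ← integral_indicator measurableSet_Ioc]
      congr 1
      funext t
      by_cases h3 : a < t <;> by_cases h4 : t ≤ (u : Space m → ℝ) x
      · have : t ≤ b := h4.trans hxb.le
        simp [indicator, h3, h4, this]
      · simp [indicator, h3, h4]
      · simp [indicator, h3]
      · simp [indicator, h3]
    · have h0 : dirAdjoint X φ x = 0 :=
        image_eq_zero_of_notMem_tsupport fun h => hx (tsupport_dirAdjoint_subset X φ h)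
      simp [indicator, h0]
  rw [h1]
  simp only [h2]
  rw [integral_integral_swap (integrable_indicator_prod (dirAdjoint X φ) hv a b),
    ← integral_indicator measurableSet_Ioc]
  congr 1
  funext t
  by_cases ht : t ∈ Ioc a b
  · rw [indicator_of_mem ht, integral_mul_const, mul_comm]
    rfl
  · rw [indicator_of_notMem ht, superlevelIntegral_dirAdjoint_eq_zero hab ht, mul_zero]

/-- The fundamental theorem of calculus for superlevel integrals, which underlies their smoothness:
the derivative of `t ↦ ∫_{t ≤ u} φ` is `t ↦ -∫_{t ≤ u} X^* φ`. -/
theorem superlevelIntegral_eq_sub {φ : Test m}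
    (hX : ∀ x ∈ tsupport φ, (dirDeriv X u : Space m → ℝ) x = 1) (t : ℝ) :
    superlevelIntegral u φ t = (∫ s in Ioi (0 : ℝ), superlevelIntegral u (dirAdjoint X φ) s) -
      ∫ s in (0 : ℝ)..t, superlevelIntegral u (dirAdjoint X φ) s := by
  have hint := integrable_superlevelIntegral (X := X) (u := u) φ
  have h1 := (isLevelDensity_superlevelIntegral X u φ).integral_indicator hint t
  rw [mulTest_eq_self hX] at h1
  rw [← intervalIntegral.integral_interval_add_Ioi (a := 0) (b := t) hint.integrableOn
    hint.integrableOn, add_sub_cancel_left, ← integral_Ici_eq_integral_Ioi]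
  exact h1

theorem continuous_superlevelIntegral {φ : Test m}
    (hX : ∀ x ∈ tsupport φ, (dirDeriv X u : Space m → ℝ) x = 1) :
    Continuous (superlevelIntegral u φ) := by
  rw [funext (superlevelIntegral_eq_sub hX)]
  exact continuous_const.sub (intervalIntegral.continuous_primitive
    (fun _ _ => (integrable_superlevelIntegral (X := X) (u := u) φ).intervalIntegrable) 0)

theorem hasDerivAt_superlevelIntegral {φ : Test m}
    (hX : ∀ x ∈ tsupport φ, (dirDeriv X u : Space m → ℝ) x = 1) (t : ℝ) :
    HasDerivAt (superlevelIntegral u φ) (-superlevelIntegral u (dirAdjoint X φ) t) t := by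
  rw [funext (superlevelIntegral_eq_sub hX)]
  have hc : Continuous (superlevelIntegral u (dirAdjoint X φ)) :=
    continuous_superlevelIntegral fun x hx => hX x (tsupport_dirAdjoint_subset X φ hx)
  exact (hc.integral_hasStrictDerivAt 0 t).hasDerivAt.const_sub _

theorem tsupport_dirAdjoint_iterate_subset (X : Fin m → SmoothFun m) (φ : Test m) (k : ℕ) :
    tsupport ((dirAdjoint X)^[k] φ) ⊆ tsupport φ := by
  induction k with
  | zero => exact subset_rfl
  | succ k ih =>
    rw [Function.iterate_succ_apply']
    exact (tsupport_dirAdjoint_subset X _).trans ih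

theorem iteratedDeriv_superlevelIntegral {φ : Test m}
    (hX : ∀ x ∈ tsupport φ, (dirDeriv X u : Space m → ℝ) x = 1) (k : ℕ) :
    iteratedDeriv k (superlevelIntegral u φ) =
      fun t => (-1) ^ k * superlevelIntegral u ((dirAdjoint X)^[k] φ) t := by
  induction k with
  | zero => simp
  | succ k ih =>
    funext t
    rw [iteratedDeriv_succ, ih, Function.iterate_succ_apply']
    have := (hasDerivAt_superlevelIntegral (fun x hx =>
      hX x (tsupport_dirAdjoint_iterate_subset X φ k hx)) t).const_mul ((-1 : ℝ) ^ k)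
    rw [this.deriv, pow_succ]
    ring

theorem contDiff_superlevelIntegral {φ : Test m}
    (hX : ∀ x ∈ tsupport φ, (dirDeriv X u : Space m → ℝ) x = 1) :
    ContDiff ℝ ∞ (superlevelIntegral u φ) := by
  refine contDiff_of_differentiable_iteratedDeriv fun k _ t => ?_
  rw [iteratedDeriv_superlevelIntegral hX]
  exact (hasDerivAt_superlevelIntegral (fun x hx =>
      hX x (tsupport_dirAdjoint_iterate_subset X φ k hx)) t).differentiableAt.const_mul _

/-- If `u` has no critical points on the support of `φ`, then `(Y u) φ` has a smooth, compactly
supported level density for every vector field `Y`. -/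
theorem exists_isLevelDensity_dirDeriv {φ : Test m}
    (hφ : ∀ x ∈ tsupport φ, fderiv ℝ (u : Space m → ℝ) x ≠ 0) (Y : Fin m → SmoothFun m) :
    ∃ ψ : 𝓓((⊤ : Opens ℝ), ℝ), IsLevelDensity u (mulTest (dirDeriv Y u) φ) ψ ∧
      (ψ : ℝ → ℝ) = superlevelIntegral u (dirAdjoint Y φ) := by
  obtain ⟨X, hX⟩ := exists_dirDeriv_eq_one u (isClosed_tsupport φ) hφ
  obtain ⟨a, b, -, hab⟩ := exists_bounds_on_tsupport u φ
  have hX' : ∀ x ∈ tsupport (dirAdjoint Y φ), (dirDeriv X u : Space m → ℝ) x = 1 :=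
    fun x hx => hX x (tsupport_dirAdjoint_subset Y φ hx)
  exact ⟨⟨superlevelIntegral u (dirAdjoint Y φ), contDiff_superlevelIntegral hX',
    HasCompactSupport.intro (isCompact_Icc (a := a) (b := b)) fun t ht =>
      superlevelIntegral_dirAdjoint_eq_zero hab fun h => ht (Ioc_subset_Icc_self h),
    fun _ _ => trivial⟩, isLevelDensity_superlevelIntegral Y u φ, rfl⟩

theorem fderiv_ne_zero_of_dirDeriv_eq_one {x : Space m}
    (h : (dirDeriv X u : Space m → ℝ) x = 1) : fderiv ℝ (u : Space m → ℝ) x ≠ 0 := by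
  intro h0
  rw [dirDeriv_apply, h0] at h
  simp at h

/-- If `X u = 1` on the support of `φ`, the derivatives at `0` of the level density of `φ` are
integrals over `{0 ≤ u}`. -/
theorem exists_isLevelDensity_of_dirDeriv_eq_one {φ : Test m}
    (hX : ∀ x ∈ tsupport φ, (dirDeriv X u : Space m → ℝ) x = 1) :
    ∃ ψ : 𝓓((⊤ : Opens ℝ), ℝ), IsLevelDensity u φ ψ ∧
      ∀ k, (-1) ^ k * iteratedDeriv k ψ 0 = superlevelIntegral u ((dirAdjoint X)^[k + 1] φ) 0 := by
  obtain ⟨ψ, hψ, hψ'⟩ := exists_isLevelDensity_dirDeriv (u := u) (φ := φ)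
    (fun x hx => fderiv_ne_zero_of_dirDeriv_eq_one (hX x hx)) X
  rw [mulTest_eq_self hX] at hψ
  refine ⟨ψ, hψ, fun k => ?_⟩
  rw [hψ', iteratedDeriv_superlevelIntegral
    fun x hx => hX x (tsupport_dirAdjoint_subset X φ hx), ← mul_assoc, ← mul_pow,
    Function.iterate_succ_apply]
  simp

end UnitSpeed

theorem exists_isLevelDensity {m : ℕ} (u : SmoothFun m) (φ : Test m)
    (hφ : ∀ x ∈ tsupport φ, fderiv ℝ (u : Space m → ℝ) x ≠ 0) :
    ∃ ψ : 𝓓((⊤ : Opens ℝ), ℝ), IsLevelDensity u φ ψ := by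
  obtain ⟨X, hX⟩ := exists_dirDeriv_eq_one u (isClosed_tsupport φ) hφ
  obtain ⟨ψ, hψ, -⟩ := exists_isLevelDensity_of_dirDeriv_eq_one hX
  exact ⟨ψ, hψ⟩

theorem heavisideComp_apply {m : ℕ} (u : SmoothFun m) (φ : Test m) :
    heavisideComp (u : Space m → ℝ) φ = superlevelIntegral u φ 0 := by
  change TestFunction.integralAgainstBilinCLM (ContinuousLinearMap.mul ℝ ℝ) volume
    ({x | 0 ≤ (u : Space m → ℝ) x}.indicator 1) φ = _
  rw [TestFunction.integralAgainstBilinCLM_eq_integral]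
  · refine integral_congr_ae (ae_of_all _ fun x => ?_)
    by_cases hx : 0 ≤ (u : Space m → ℝ) x <;> simp [indicator, hx]
  · refine LocallyIntegrable.locallyIntegrableOn ?_ _
    exact (locallyIntegrable_const (1 : ℝ)).indicator
      (measurableSet_le measurable_const (continuous_coe u).measurable)

/-! ### Approximation of the derivatives of the Dirac distribution -/

theorem contDiff_iteratedDeriv {ρ : ℝ → ℝ} (hρ : ContDiff ℝ ∞ ρ) (k : ℕ) :
    ContDiff ℝ ∞ (iteratedDeriv k ρ) := by
  rw [iteratedDeriv_eq_iterate]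
  exact ContDiff.iterate_deriv k hρ

theorem hasCompactSupport_iteratedDeriv {ρ : ℝ → ℝ} (hc : HasCompactSupport ρ) (k : ℕ) :
    HasCompactSupport (iteratedDeriv k ρ) := by
  induction k with
  | zero => simpa using hc
  | succ k ih =>
    rw [iteratedDeriv_succ]
    exact ih.deriv

theorem integral_iteratedDeriv_mul {ρ : ℝ → ℝ} (hρ : ContDiff ℝ ∞ ρ) (hc : HasCompactSupport ρ)
    (k : ℕ) {ψ : ℝ → ℝ} (hψ : ContDiff ℝ ∞ ψ) :
    ∫ t, iteratedDeriv k ρ t * ψ t = (-1) ^ k * ∫ t, ρ t * iteratedDeriv k ψ t := by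
  induction k generalizing ψ with
  | zero => simp
  | succ k ih =>
    have hρk : ContDiff ℝ ∞ (iteratedDeriv k ρ) := contDiff_iteratedDeriv hρ k
    have hψ' : ContDiff ℝ ∞ (deriv ψ) := by simpa using ContDiff.iterate_deriv 1 hψ
    have hck : HasCompactSupport (iteratedDeriv k ρ) := hasCompactSupport_iteratedDeriv hc k
    have h := integral_mul_deriv_eq_deriv_mul_of_integrable
      (u := ψ) (v := iteratedDeriv k ρ) (u' := deriv ψ) (v' := deriv (iteratedDeriv k ρ))
      (fun x _ => (hψ.differentiable (by simp) x).hasDerivAt)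
      (fun x _ => (hρk.differentiable (by simp) x).hasDerivAt)
      ((hψ.continuous.mul (hρk.continuous_deriv (by simp))).integrable_of_hasCompactSupport
        hck.deriv.mul_left)
      ((hψ'.continuous.mul hρk.continuous).integrable_of_hasCompactSupport hck.mul_left)
      ((hψ.continuous.mul hρk.continuous).integrable_of_hasCompactSupport hck.mul_left)
    rw [iteratedDeriv_succ, iteratedDeriv_succ']
    simp only [mul_comm _ (ψ _)]
    rw [h]
    simp only [mul_comm (deriv ψ _)]
    rw [ih hψ', pow_succ]
    ring

/-- Smooth approximations of `δ^{(k)}` exist: derivatives of normalized bump functions. -/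
theorem exists_tendstoDirac (k : ℕ) :
    ∃ v : ℕ → ℝ → ℝ, (∀ i, ContDiff ℝ ∞ (v i)) ∧ TendstoDirac k v := by
  let f : ℕ → ContDiffBump (0 : ℝ) := fun i =>
    { rIn := 1 / (2 * ((i : ℝ) + 1)), rOut := 1 / ((i : ℝ) + 1)
      rIn_pos := by positivity
      rIn_lt_rOut := by
        apply one_div_lt_one_div_of_lt <;> nlinarith [(Nat.cast_nonneg i : (0 : ℝ) ≤ i)] }
  have hf : ∀ i, ContDiff ℝ ∞ ((f i).normed volume) := fun i => (f i).contDiff_normed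
  refine ⟨fun i => iteratedDeriv k ((f i).normed volume),
    fun i => contDiff_iteratedDeriv (hf i) k, fun ψ => ?_⟩
  have hip : ∀ i, ∫ t, iteratedDeriv k ((f i).normed volume) t * ψ t
      = (-1) ^ k * ∫ t, (f i).normed volume t * iteratedDeriv k ψ t := fun i =>
    integral_iteratedDeriv_mul (hf i) (f i).hasCompactSupport_normed k ψ.contDiff
  refine Tendsto.congr (fun i => (hip i).symm) (Tendsto.const_mul _ ?_)
  have hg : Continuous fun t => iteratedDeriv k ψ (-t) :=
    (contDiff_iteratedDeriv ψ.contDiff k).continuous.comp continuous_neg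
  have := ContDiffBump.convolution_tendsto_right_of_continuous (μ := volume) (φ := f)
    tendsto_one_div_add_atTop_nhds_zero_nat hg 0
  simpa [convolution] using this

/-! ### The distributions `δ^{(k)}(u)` -/

theorem IsLevelDensity.tendsto {m k : ℕ} {u : SmoothFun m} {φ : Test m}
    {ψ : 𝓓((⊤ : Opens ℝ), ℝ)} (h : IsLevelDensity u φ ψ) {v : ℕ → ℝ → ℝ}
    (hv : ∀ i, ContDiff ℝ ∞ (v i)) (hlim : TendstoDirac k v) :
    Tendsto (fun i => ∫ x, v i ((u : Space m → ℝ) x) * φ x) atTop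
      (𝓝 ((-1) ^ k * iteratedDeriv k ψ 0)) :=
  (hlim ψ).congr fun i => (h (v i) (hv i).continuous).symm

theorem eq_zero_of_integral_mul_self_eq_zero {c ψ : ℝ → ℝ} (hc : Continuous c)
    (hc0 : ∀ t, 0 ≤ c t) (hψ : Continuous ψ) (hψc : HasCompactSupport ψ)
    (h : ∫ t, c t * ψ t * ψ t = 0) {t : ℝ} (ht : 0 < c t) : ψ t = 0 := by
  by_contra hne
  have := Continuous.integral_pos_of_hasCompactSupport_nonneg_nonzero (μ := volume) (x := t)
    (f := fun t => c t * ψ t * ψ t) ((hc.mul hψ).mul hψ) hψc.mul_left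
    (fun t => (mul_nonneg (hc0 t) (mul_self_nonneg (ψ t))).trans_eq (mul_assoc _ _ _).symm)
    (mul_ne_zero (mul_ne_zero ht.ne' hne) hne)
  exact this.ne' h

/-- If `u` has no zeros on the support of `φ`, then the level density `ψ` vanishes near `0`: test
it against `c ψ`, where `c ≥ 0` vanishes on `u(supp φ)` and `c > 0` near `0`. -/
theorem IsLevelDensity.iteratedDeriv_eq_zero {m : ℕ} {u : SmoothFun m} {φ : Test m}
    {ψ : 𝓓((⊤ : Opens ℝ), ℝ)} (h : IsLevelDensity u φ ψ)
    (hφ : ∀ x ∈ tsupport φ, (u : Space m → ℝ) x ≠ 0) (k : ℕ) : iteratedDeriv k ψ 0 = 0 := by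
  -- The point `1` is adjoined since `Metric.infDist` to the empty set vanishes identically.
  set K : Set ℝ := insert 1 ((u : Space m → ℝ) '' tsupport φ)
  have hK : IsCompact K := (IsCompact.image φ.hasCompactSupport (continuous_coe u)).insert 1
  have h0 : (0 : ℝ) ∉ K := by
    rintro (h1 | ⟨x, hx, hx0⟩)
    · exact zero_ne_one h1
    · exact hφ x hx hx0
  have hd : Continuous fun t => Metric.infDist t K := Metric.continuous_infDist_pt K
  have h2 := h (fun t => Metric.infDist t K * ψ t) (hd.mul ψ.continuous)
  have h3 : ∀ x, Metric.infDist ((u : Space m → ℝ) x) K * ψ ((u : Space m → ℝ) x) * φ x = 0 := by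
    intro x
    by_cases hx : x ∈ tsupport φ
    · rw [Metric.infDist_zero_of_mem (mem_insert_of_mem _ (mem_image_of_mem _ hx)), zero_mul,
        zero_mul]
    · rw [image_eq_zero_of_notMem_tsupport hx, mul_zero]
  simp only [h3, integral_zero] at h2
  have hev : (ψ : ℝ → ℝ) =ᶠ[𝓝 0] fun _ => 0 := by
    filter_upwards [hK.isClosed.isOpen_compl.mem_nhds h0] with t ht
    exact eq_zero_of_integral_mul_self_eq_zero hd (fun _ => Metric.infDist_nonneg) ψ.continuous
      ψ.hasCompactSupport h2.symm
      ((hK.isClosed.notMem_iff_infDist_pos ⟨1, mem_insert _ _⟩).1 ht)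
  rw [hev.iteratedDeriv_eq k]
  simp

/-- A cutoff `χ` which is `0` near `C` and `1` near the zeros of `u`. Multiplication by `χ` and
`1 - χ` splits a test function into a part supported away from `C` and a part supported away from
the zeros of `u`. -/
theorem exists_cutoff {m : ℕ} (u : SmoothFun m) {C : Set (Space m)} (hC : IsClosed C)
    (hu : ∀ x ∈ C, (u : Space m → ℝ) x ≠ 0) : ∃ χ : SmoothFun m,
      (∀ x ∈ tsupport (χ : Space m → ℝ), x ∉ C) ∧
      (∀ x ∈ tsupport ((1 - χ : SmoothFun m) : Space m → ℝ), (u : Space m → ℝ) x ≠ 0) := by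
  obtain ⟨χ, -, h0, h1⟩ := exists_smooth_zero_one hC
    (isClosed_eq (continuous_coe u) continuous_const : IsClosed {x | (u : Space m → ℝ) x = 0})
    (Set.disjoint_left.2 hu)
  rw [eventually_nhdsSet_iff_forall] at h0 h1
  refine ⟨χ, fun x hx hxC => ?_, fun x hx hx0 => ?_⟩
  · exact notMem_tsupport_iff_eventuallyEq.2 (h0 x hxC) hx
  · refine notMem_tsupport_iff_eventuallyEq.2 ?_ hx
    filter_upwards [h1 x hx0] with y hy
    simp [hy]

theorem mulTest_add_mulTest_one_sub {m : ℕ} (χ : SmoothFun m) (φ : Test m) :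
    mulTest χ φ + mulTest (1 - χ) φ = φ := by
  ext x
  rw [add_apply, mulTest_apply, mulTest_apply]
  simp
  ring

theorem tsupport_mulTest_subset_coe {m : ℕ} (f : SmoothFun m) (φ : Test m) :
    tsupport (mulTest f φ) ⊆ tsupport (f : Space m → ℝ) :=
  tsupport_mul_subset_right (f := φ) (g := (f : Space m → ℝ))

/-- Equality of distributions can be tested locally: away from the zeros of `u`, and away from a
closed set `C` disjoint from these zeros. -/
theorem distr_ext {m : ℕ} {u : SmoothFun m} {C : Set (Space m)} (hC : IsClosed C)
    (hu : ∀ x ∈ C, (u : Space m → ℝ) x ≠ 0) {T T' : Distr m}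
    (h0 : ∀ φ : Test m, (∀ x ∈ tsupport φ, (u : Space m → ℝ) x ≠ 0) → T φ = T' φ)
    (h1 : ∀ φ : Test m, (∀ x ∈ tsupport φ, x ∉ C) → T φ = T' φ) : T = T' := by
  obtain ⟨χ, hχ, hχ'⟩ := exists_cutoff u hC hu
  ext φ
  rw [← mulTest_add_mulTest_one_sub χ φ, map_add, map_add,
    h1 _ fun x hx => hχ x (tsupport_mulTest_subset_coe _ _ hx),
    h0 _ fun x hx => hχ' x (tsupport_mulTest_subset_coe _ _ hx)]

theorem IsDiracComp.apply_eq {m k : ℕ} {u : SmoothFun m} {T : Distr m}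
    (hT : IsDiracComp k (u : Space m → ℝ) T) {φ : Test m}
    (hφ : ∀ x ∈ tsupport φ, fderiv ℝ (u : Space m → ℝ) x ≠ 0)
    {ψ : 𝓓((⊤ : Opens ℝ), ℝ)} (hψ : IsLevelDensity u φ ψ) :
    T φ = (-1) ^ k * iteratedDeriv k ψ 0 := by
  obtain ⟨v, hv, hlim⟩ := exists_tendstoDirac k
  exact tendsto_nhds_unique (hT.tendsto v hv hlim φ hφ) (hψ.tendsto hv hlim)

/-- With a vector field `X` such that `X u = 1` and a cutoff `χ` near the zeros of `u`, the
distribution `δ^{(k)}(u)` is `φ ↦ ∫_{0 ≤ u} (X^*)^{k+1} (χ φ)`. -/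
theorem exists_isDiracComp {m : ℕ} (u : SmoothFun m)
    (hu : ∀ x, (u : Space m → ℝ) x = 0 → fderiv ℝ (u : Space m → ℝ) x ≠ 0) (k : ℕ) :
    ∃ T : Distr m, IsDiracComp k (u : Space m → ℝ) T := by
  obtain ⟨χ, hχ, hχ'⟩ := exists_cutoff u (isClosed_fderiv_eq_zero u) fun x hx h => hu x h hx
  obtain ⟨X, hX⟩ := exists_dirDeriv_eq_one u (isClosed_tsupport (χ : Space m → ℝ)) hχ
  let T : Distr m := ContinuousLinearMap.precompCompactConvergenceCLM ℝ
    ((dirAdjoint X ^ (k + 1)).comp (mulTestCLM χ)) (heavisideComp (u : Space m → ℝ))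
  have hT : ∀ φ, T φ = superlevelIntegral u ((dirAdjoint X)^[k + 1] (mulTest χ φ)) 0 := by
    intro φ
    have hpow : ⇑(dirAdjoint X ^ (k + 1)) = (dirAdjoint X)^[k + 1] :=
      hom_coe_pow _ rfl (fun _ _ => rfl) _ _
    rw [← heavisideComp_apply, ← hpow]
    rfl
  have key : ∀ φ : Test m, ∃ ψ : 𝓓((⊤ : Opens ℝ), ℝ), IsLevelDensity u (mulTest χ φ) ψ ∧
      T φ = (-1) ^ k * iteratedDeriv k ψ 0 := by
    intro φ
    obtain ⟨ψ, hψ, hψ'⟩ := exists_isLevelDensity_of_dirDeriv_eq_one (φ := mulTest χ φ)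
      fun x hx => hX x (tsupport_mulTest_subset_coe _ _ hx)
    exact ⟨ψ, hψ, by rw [hT, hψ']⟩
  refine ⟨T, fun v hv hlim φ hφ => ?_, fun φ hφ => ?_⟩
  · obtain ⟨ψ, hψ, hψT⟩ := key φ
    obtain ⟨ψ', hψ'⟩ := exists_isLevelDensity u (mulTest (1 - χ) φ)
      fun x hx => hφ x (tsupport_mulTest_subset _ _ hx)
    have h0 := hψ'.iteratedDeriv_eq_zero
      (fun x hx => hχ' x (tsupport_mulTest_subset_coe _ _ hx)) k
    have h1 := (hψ.tendsto hv hlim).add (hψ'.tendsto hv hlim)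
    rw [h0, mul_zero, add_zero, ← hψT] at h1
    refine h1.congr fun i => ?_
    have hc : Continuous fun x => v i ((u : Space m → ℝ) x) :=
      (hv i).continuous.comp (continuous_coe u)
    rw [← integral_add (integrable_mul_test hc _) (integrable_mul_test hc _)]
    simp only [← mul_add, ← add_apply, mulTest_add_mulTest_one_sub]
  · obtain ⟨ψ, hψ, hψT⟩ := key φ
    rw [hψT, hψ.iteratedDeriv_eq_zero (fun x hx => hφ x (tsupport_mulTest_subset _ _ hx)),
      mul_zero]

theorem IsDiracComp.unique {m k : ℕ} {u : SmoothFun m}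
    (hu : ∀ x, (u : Space m → ℝ) x = 0 → fderiv ℝ (u : Space m → ℝ) x ≠ 0) {T T' : Distr m}
    (hT : IsDiracComp k (u : Space m → ℝ) T) (hT' : IsDiracComp k (u : Space m → ℝ) T') :
    T = T' := by
  refine distr_ext (isClosed_fderiv_eq_zero u) (fun x hx h => hu x h hx)
    (fun φ hφ => by rw [hT.eq_zero φ hφ, hT'.eq_zero φ hφ]) fun φ hφ => ?_
  obtain ⟨ψ, hψ⟩ := exists_isLevelDensity u φ hφ
  rw [hT.apply_eq hφ hψ, hT'.apply_eq hφ hψ]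

theorem isDiracComp_diracComp {m : ℕ} {u : SmoothFun m}
    (hu : ∀ x, (u : Space m → ℝ) x = 0 → fderiv ℝ (u : Space m → ℝ) x ≠ 0) (k : ℕ) :
    IsDiracComp k (u : Space m → ℝ) (diracComp k (u : Space m → ℝ)) := by
  have h := exists_isDiracComp u hu k
  rw [diracComp, dif_pos h]
  exact h.choose_spec

/-! ### Relations between the distributions `δ^{(k)}(u)` -/

theorem iteratedDeriv_id_mul {ψ : ℝ → ℝ} (hψ : ContDiff ℝ ∞ ψ) (k : ℕ) :
    iteratedDeriv (k + 1) (fun t => t * ψ t) =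
      fun t => t * iteratedDeriv (k + 1) ψ t + (k + 1) * iteratedDeriv k ψ t := by
  have hd : ∀ j t, HasDerivAt (iteratedDeriv j ψ) (iteratedDeriv (j + 1) ψ t) t := by
    intro j t
    rw [iteratedDeriv_succ]
    exact ((contDiff_iteratedDeriv hψ j).differentiable (by simp) t).hasDerivAt
  induction k with
  | zero =>
    funext t
    have h0 := (hasDerivAt_id t).mul (hd 0 t)
    rw [iteratedDeriv_zero] at h0
    rw [iteratedDeriv_succ, iteratedDeriv_zero]
    refine h0.deriv.trans ?_
    simp
    ring
  | succ k ih =>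
    funext t
    rw [iteratedDeriv_succ, ih]
    refine (((hasDerivAt_id t).mul (hd (k + 1) t)).add
      ((hd k t).const_mul ((k : ℝ) + 1))).deriv.trans ?_
    simp
    ring

theorem IsLevelDensity.mulTest_self {m : ℕ} {u : SmoothFun m} {φ : Test m} {ψ : ℝ → ℝ}
    (h : IsLevelDensity u φ ψ) : IsLevelDensity u (mulTest u φ) fun t => t * ψ t := by
  intro v hv
  have := h (fun t => v t * t) (hv.mul continuous_id)
  simp only [mul_assoc] at this
  rw [← this]
  refine integral_congr_ae (ae_of_all _ fun x => ?_)
  simp only [mulTest_apply]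
  ring

/-- The sequence `H(u), δ(u), δ'(u), δ''(u), …` of successive derivatives. -/
def heavisideDerivComp {m : ℕ} (u : SmoothFun m) : ℕ → Distr m
  | 0 => heavisideComp (u : Space m → ℝ)
  | k + 1 => diracComp k (u : Space m → ℝ)

/-- The relation `t H^{(j+1)}(t) = -j H^{(j)}(t)`, pulled back by `u`. -/
theorem heavisideDerivComp_succ_mulTest_self {m : ℕ} {u : SmoothFun m}
    (hu : ∀ x, (u : Space m → ℝ) x = 0 → fderiv ℝ (u : Space m → ℝ) x ≠ 0) (j : ℕ) {φ : Test m}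
    (hφ : ∀ x ∈ tsupport φ, fderiv ℝ (u : Space m → ℝ) x ≠ 0) :
    heavisideDerivComp u (j + 1) (mulTest u φ) = -j * heavisideDerivComp u j φ := by
  obtain ⟨ψ, hψ⟩ := exists_isLevelDensity u φ hφ
  let ψ' : 𝓓((⊤ : Opens ℝ), ℝ) := ⟨fun t => t * ψ t, contDiff_id.mul ψ.contDiff,
    ψ.hasCompactSupport.mul_left, fun _ _ => trivial⟩
  have hψ' : IsLevelDensity u (mulTest u φ) ψ' := hψ.mulTest_self
  have hreg : ∀ x ∈ tsupport (mulTest u φ), fderiv ℝ (u : Space m → ℝ) x ≠ 0 :=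
    fun x hx => hφ x (tsupport_mulTest_subset _ _ hx)
  change diracComp j _ _ = _
  rw [(isDiracComp_diracComp hu j).apply_eq hreg hψ']
  change (-1) ^ j * iteratedDeriv j (fun t => t * ψ t) 0 = _
  cases j with
  | zero => simp
  | succ k =>
    change _ = _ * diracComp k _ _
    rw [(isDiracComp_diracComp hu k).apply_eq hφ hψ, iteratedDeriv_id_mul ψ.contDiff]
    push_cast
    ring

/-- The chain rule `Y (H^{(j)}(u)) = (Y u) H^{(j+1)}(u)`. -/
theorem heavisideDerivComp_succ_mulTest_dirDeriv {m : ℕ} {u : SmoothFun m}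
    (hu : ∀ x, (u : Space m → ℝ) x = 0 → fderiv ℝ (u : Space m → ℝ) x ≠ 0) (j : ℕ) {φ : Test m}
    (hφ : ∀ x ∈ tsupport φ, fderiv ℝ (u : Space m → ℝ) x ≠ 0) (Y : Fin m → SmoothFun m) :
    heavisideDerivComp u (j + 1) (mulTest (dirDeriv Y u) φ)
      = heavisideDerivComp u j (dirAdjoint Y φ) := by
  have hreg : ∀ x ∈ tsupport (mulTest (dirDeriv Y u) φ), fderiv ℝ (u : Space m → ℝ) x ≠ 0 :=
    fun x hx => hφ x (tsupport_mulTest_subset _ _ hx)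
  have hreg' : ∀ x ∈ tsupport (dirAdjoint Y φ), fderiv ℝ (u : Space m → ℝ) x ≠ 0 :=
    fun x hx => hφ x (tsupport_dirAdjoint_subset _ _ hx)
  cases j with
  | zero =>
    obtain ⟨ψ, hψ, hψ'⟩ := exists_isLevelDensity_dirDeriv hφ Y
    change diracComp 0 _ _ = heavisideComp _ _
    rw [(isDiracComp_diracComp hu 0).apply_eq hreg hψ, heavisideComp_apply, ← hψ']
    simp
  | succ k =>
    obtain ⟨v, hv, hlim⟩ := exists_tendstoDirac k
    have hv' : ∀ i, ContDiff ℝ ∞ (deriv (v i)) := fun i => by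
      simpa using ContDiff.iterate_deriv 1 (hv i)
    have hlim' : TendstoDirac (k + 1) fun i => deriv (v i) := by
      intro ψ
      let dψ : 𝓓((⊤ : Opens ℝ), ℝ) := ⟨deriv ψ, by simpa using ContDiff.iterate_deriv 1 ψ.contDiff,
        ψ.hasCompactSupport.deriv, fun _ _ => trivial⟩
      have h1 := (hlim dψ).neg
      have h2 : (-1) ^ (k + 1) * iteratedDeriv (k + 1) ψ 0
          = -((-1) ^ k * iteratedDeriv k dψ 0) := by
        rw [iteratedDeriv_succ', pow_succ]
        change _ = -((-1) ^ k * iteratedDeriv k (deriv ψ) 0)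
        ring
      rw [h2]
      refine h1.congr fun i => ?_
      have hibp := integral_mul_deriv_eq_deriv_mul_of_integrable
        (u := v i) (v := ψ) (u' := deriv (v i)) (v' := deriv ψ)
        (fun x _ => ((hv i).differentiable (by simp) x).hasDerivAt)
        (fun x _ => (ψ.contDiff.differentiable (by simp) x).hasDerivAt)
        (((hv i).continuous.mul dψ.continuous).integrable_of_hasCompactSupport
          dψ.hasCompactSupport.mul_left)
        (((hv' i).continuous.mul ψ.continuous).integrable_of_hasCompactSupport
          ψ.hasCompactSupport.mul_left)
        (((hv i).continuous.mul ψ.continuous).integrable_of_hasCompactSupport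
          ψ.hasCompactSupport.mul_left)
      exact (neg_eq_iff_eq_neg.2 hibp)
    have h1 := (isDiracComp_diracComp hu (k + 1)).tendsto _ hv' hlim' _ hreg
    have h2 := (isDiracComp_diracComp hu k).tendsto _ hv hlim _ hreg'
    refine tendsto_nhds_unique h1 (h2.congr fun i => ?_)
    exact (integral_comp_mul_dirDeriv Y u φ
      (fun t => ((hv i).differentiable (by simp) t).hasDerivAt) (hv' i).continuous).symm

theorem heavisideComp_mul {m : ℕ} {h u : SmoothFun m} (hh : ∀ x, 0 < (h : Space m → ℝ) x) :
    heavisideComp ((h * u : SmoothFun m) : Space m → ℝ) = heavisideComp (u : Space m → ℝ) := by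
  have h1 : ∀ x, 0 ≤ ((h * u : SmoothFun m) : Space m → ℝ) x ↔ 0 ≤ (u : Space m → ℝ) x :=
    fun x => mul_nonneg_iff_of_pos_left (hh x)
  ext φ
  rw [heavisideComp_apply, heavisideComp_apply]
  simp only [superlevelIntegral, h1]

/-- Homogeneity of `H^{(j)}`: `h^j H^{(j)}(h u) = H^{(j)}(u)` for a positive function `h`, by
induction on `j` with the chain rule along a field `Y` with `Y (h u) = 1`. -/
theorem heavisideDerivComp_mul_apply {m : ℕ} {h u : SmoothFun m}
    (hh : ∀ x, 0 < (h : Space m → ℝ) x)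
    (hu : ∀ x, (u : Space m → ℝ) x = 0 → fderiv ℝ (u : Space m → ℝ) x ≠ 0)
    (hhu : ∀ x, ((h * u : SmoothFun m) : Space m → ℝ) x = 0 →
      fderiv ℝ ((h * u : SmoothFun m) : Space m → ℝ) x ≠ 0) (j : ℕ) {φ : Test m}
    (hφ : ∀ x ∈ tsupport φ, fderiv ℝ (u : Space m → ℝ) x ≠ 0)
    (hφ' : ∀ x ∈ tsupport φ, fderiv ℝ ((h * u : SmoothFun m) : Space m → ℝ) x ≠ 0) :
    heavisideDerivComp (h * u) j (mulTest (h ^ j) φ) = heavisideDerivComp u j φ := by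
  induction j generalizing φ with
  | zero =>
    change heavisideComp _ _ = heavisideComp _ _
    rw [heavisideComp_mul hh, pow_zero, mulTest_eq_self fun _ _ => rfl]
  | succ j ih =>
    obtain ⟨Y, hY⟩ := exists_dirDeriv_eq_one (h * u) (isClosed_tsupport φ) hφ'
    have hY1 : mulTest (dirDeriv Y (h * u)) φ = φ := mulTest_eq_self hY
    have hYsub := tsupport_dirAdjoint_subset Y φ
    -- `Y^* (h^{j+1} φ) = h^j (h Y^* φ - (j + 1) (Y h) φ)`
    let ξ : Test m := mulTest h (dirAdjoint Y φ) - ((j : ℝ) + 1) • mulTest (dirDeriv Y h) φ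
    have hpow : ∀ n : ℕ, dirDeriv Y (h ^ (n + 1)) = ((n : ℝ) + 1) • (h ^ n * dirDeriv Y h) := by
      intro n
      induction n with
      | zero => simp
      | succ n ihn =>
        rw [pow_succ, dirDeriv_mul, ihn]
        ext x
        simp
        ring
    have hξ : dirAdjoint Y (mulTest (h ^ (j + 1)) φ) = mulTest (h ^ j) ξ := by
      rw [dirAdjoint_mulTest, hpow]
      ext x
      simp only [ξ, sub_apply, smul_apply, mulTest_apply]
      simp
      ring
    have hξsub : tsupport ξ ⊆ tsupport φ := by
      refine closure_minimal (fun x hx => ?_) (isClosed_tsupport _)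
      by_contra hx'
      refine hx ?_
      have h1 : φ x = 0 := image_eq_zero_of_notMem_tsupport hx'
      have h2 : dirAdjoint Y φ x = 0 := image_eq_zero_of_notMem_tsupport fun h => hx' (hYsub h)
      simp only [ξ, sub_apply, smul_apply, mulTest_apply, h1, h2, zero_mul, smul_zero, sub_zero]
    have e1 : heavisideDerivComp (h * u) (j + 1) (mulTest (h ^ (j + 1)) φ)
        = heavisideDerivComp u j ξ := by
      rw [← ih (φ := ξ) (fun x hx => hφ x (hξsub hx)) (fun x hx => hφ' x (hξsub hx)), ← hξ,
        ← heavisideDerivComp_succ_mulTest_dirDeriv hhu j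
          (fun x hx => hφ' x (tsupport_mulTest_subset _ _ hx)) Y]
      congr 1
      rw [mulTest_eq_self fun x hx => hY x (tsupport_mulTest_subset _ _ hx)]
    have e2 : ξ = dirAdjoint Y (mulTest h φ) - (j : ℝ) • mulTest (dirDeriv Y h) φ := by
      rw [dirAdjoint_mulTest]
      ext x
      simp only [ξ, sub_apply, smul_apply, mulTest_apply, smul_eq_mul]
      ring
    have e3 : mulTest (dirDeriv Y u) (mulTest h φ) + mulTest u (mulTest (dirDeriv Y h) φ) = φ := by
      conv_rhs => rw [← hY1]
      rw [dirDeriv_mul]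
      ext x
      simp only [add_apply, mulTest_apply]
      change _ = φ x * ((h : Space m → ℝ) x * (dirDeriv Y u : Space m → ℝ) x
        + (u : Space m → ℝ) x * (dirDeriv Y h : Space m → ℝ) x)
      ring
    rw [e1, e2, map_sub, map_smul, ← heavisideDerivComp_succ_mulTest_dirDeriv hu j
      (fun x hx => hφ x (tsupport_mulTest_subset _ _ hx)) Y]
    conv_rhs => rw [← e3]
    rw [map_add, heavisideDerivComp_succ_mulTest_self hu j
      (fun x hx => hφ x (tsupport_mulTest_subset _ _ hx))]
    simp
    ring

/-- The relation `u δ^{(k+1)}(u) = -(k+1) δ^{(k)}(u)`. -/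
theorem smulDistr_diracComp_succ {m : ℕ} {u : SmoothFun m}
    (hu : ∀ x, (u : Space m → ℝ) x = 0 → fderiv ℝ (u : Space m → ℝ) x ≠ 0) (k : ℕ) :
    smulDistr m u (diracComp (k + 1) (u : Space m → ℝ)) =
      (-((k : ℝ) + 1)) • diracComp k (u : Space m → ℝ) := by
  have h1 := isDiracComp_diracComp hu (k + 1)
  have h0 := isDiracComp_diracComp hu k
  refine distr_ext (isClosed_fderiv_eq_zero u) (fun x hx h => hu x h hx)
    (fun φ hφ => ?_) fun φ hφ => ?_
  · rw [smul_apply, h0.eq_zero _ hφ, smul_zero]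
    exact h1.eq_zero _ fun x hx => hφ x (tsupport_mulTest_subset _ _ hx)
  · have := heavisideDerivComp_succ_mulTest_self hu (k + 1) hφ
    rw [Nat.cast_add_one] at this
    exact this

theorem smulDistr_diracComp_zero {m : ℕ} {u : SmoothFun m}
    (hu : ∀ x, (u : Space m → ℝ) x = 0 → fderiv ℝ (u : Space m → ℝ) x ≠ 0) :
    smulDistr m u (diracComp 0 (u : Space m → ℝ)) = 0 := by
  have h1 := isDiracComp_diracComp hu 0
  refine distr_ext (isClosed_fderiv_eq_zero u) (fun x hx h => hu x h hx)
    (fun φ hφ => ?_) fun φ hφ => ?_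
  · exact h1.eq_zero _ fun x hx => hφ x (tsupport_mulTest_subset _ _ hx)
  · have := heavisideDerivComp_succ_mulTest_self hu 0 hφ
    rw [Nat.cast_zero, neg_zero, zero_mul] at this
    exact this

/-- Homogeneity of `δ^{(k)}`: `h^{k+1} δ^{(k)}(h u) = δ^{(k)}(u)` for a positive function `h`. -/
theorem smulDistr_pow_diracComp_mul {m : ℕ} {h u : SmoothFun m}
    (hh : ∀ x, 0 < (h : Space m → ℝ) x)
    (hu : ∀ x, (u : Space m → ℝ) x = 0 → fderiv ℝ (u : Space m → ℝ) x ≠ 0)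
    (hhu : ∀ x, ((h * u : SmoothFun m) : Space m → ℝ) x = 0 →
      fderiv ℝ ((h * u : SmoothFun m) : Space m → ℝ) x ≠ 0) (k : ℕ) :
    smulDistr m (h ^ (k + 1)) (diracComp k ((h * u : SmoothFun m) : Space m → ℝ)) =
      diracComp k (u : Space m → ℝ) := by
  have hz : ∀ x, ((h * u : SmoothFun m) : Space m → ℝ) x = 0 ↔ (u : Space m → ℝ) x = 0 :=
    fun x => mul_eq_zero_iff_left (hh x).ne'
  refine distr_ext ((isClosed_fderiv_eq_zero u).union (isClosed_fderiv_eq_zero (h * u)))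
    (fun x hx h0 => hx.elim (hu x h0) (hhu x ((hz x).2 h0)))
    (fun φ hφ => ?_) fun φ hφ => ?_
  · rw [(isDiracComp_diracComp hu k).eq_zero _ hφ]
    exact (isDiracComp_diracComp hhu k).eq_zero _ fun x hx h0 =>
      hφ x (tsupport_mulTest_subset _ _ hx) ((hz x).1 h0)
  · exact heavisideDerivComp_mul_apply hh hu hhu (k + 1)
      (fun x hx h0 => hφ x hx (Or.inl h0)) fun x hx h0 => hφ x hx (Or.inr h0)

/-! ### Even elements of the Grassmann algebra -/

section Grassmann

variable {n : ℕ}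

/-- The span `⨁_{k ≥ d} Λ^k` of the monomials of degree at least `d`. -/
def degreeGE (n d : ℕ) : Submodule ℝ (Grassmann n) :=
  ⨆ k : ℕ, LinearMap.range (ExteriorAlgebra.ι ℝ (M := Fin (2 * n) → ℝ)) ^ (d + k)

theorem pow_le_degreeGE {d k : ℕ} (h : d ≤ k) :
    LinearMap.range (ExteriorAlgebra.ι ℝ (M := Fin (2 * n) → ℝ)) ^ k ≤ degreeGE n d := by
  obtain ⟨l, rfl⟩ := Nat.exists_eq_add_of_le h
  exact le_iSup (fun k : ℕ =>
    LinearMap.range (ExteriorAlgebra.ι ℝ (M := Fin (2 * n) → ℝ)) ^ (d + k)) l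

theorem degreeGE_mul_le (a b : ℕ) : degreeGE n a * degreeGE n b ≤ degreeGE n (a + b) := by
  rw [degreeGE, degreeGE, Submodule.iSup_mul]
  refine iSup_le fun k => ?_
  rw [Submodule.mul_iSup]
  refine iSup_le fun l => ?_
  rw [← pow_add]
  exact pow_le_degreeGE (by omega)

theorem degreeGE_eq_bot {d : ℕ} (hd : 2 * n < d) : degreeGE n d = ⊥ := by
  refine iSup_eq_bot.2 fun k => ?_
  have h : Module.finrank ℝ (⋀[ℝ]^(d + k) (Fin (2 * n) → ℝ)) = 0 := by
    rw [exteriorPower.finrank_eq, Module.finrank_fin_fun]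
    exact Nat.choose_eq_zero_of_lt (by omega)
  exact Submodule.finrank_eq_zero.1 h

theorem algebraMapInv_eq_zero {k : ℕ} {x : Grassmann n}
    (hx : x ∈ LinearMap.range (ExteriorAlgebra.ι ℝ (M := Fin (2 * n) → ℝ)) ^ (k + 1)) :
    ExteriorAlgebra.algebraMapInv x = (0 : ℝ) := by
  have h1 : (LinearMap.range (ExteriorAlgebra.ι ℝ (M := Fin (2 * n) → ℝ))).map
      (ExteriorAlgebra.algebraMapInv (R := ℝ) (M := Fin (2 * n) → ℝ)).toLinearMap = ⊥ := by
    rw [← LinearMap.range_comp, LinearMap.range_eq_bot]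
    ext v
    simp [ExteriorAlgebra.algebraMapInv]
  have h2 := Submodule.mem_map_of_mem
    (f := (ExteriorAlgebra.algebraMapInv (R := ℝ) (M := Fin (2 * n) → ℝ)).toLinearMap) hx
  rw [Submodule.map_pow, h1, Submodule.bot_pow k.succ_ne_zero] at h2
  exact h2

/-- The nilpotent part of an even element starts in degree two. -/
theorem sub_algebraMapInv_mem_degreeGE {x : Grassmann n} (hx : x ∈ evenGrassmann n) :
    x - algebraMap ℝ _ (ExteriorAlgebra.algebraMapInv x) ∈ degreeGE n 2 := by
  let L : Grassmann n →ₗ[ℝ] Grassmann n := LinearMap.id -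
    (Algebra.linearMap ℝ (Grassmann n)) ∘ₗ (ExteriorAlgebra.algebraMapInv).toLinearMap
  suffices h : evenGrassmann n ≤ (degreeGE n 2).comap L from h hx
  refine iSup_le fun ⟨j, hj⟩ => fun y hy => ?_
  change y - algebraMap ℝ _ (ExteriorAlgebra.algebraMapInv y) ∈ degreeGE n 2
  have hj2 : Even j := by rwa [ZMod.natCast_eq_zero_iff_even] at hj
  rcases j with _ | _ | j
  · obtain ⟨r, rfl⟩ : ∃ r : ℝ, algebraMap ℝ (Grassmann n) r = y := by
      simpa [Submodule.mem_one] using hy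
    simp
  · simp at hj2
  · rw [algebraMapInv_eq_zero hy, map_zero, sub_zero]
    exact pow_le_degreeGE (Nat.le_add_left 2 j) hy

/-- Products of two generators commute with every generator, so even elements are central. -/
theorem evenGrassmann_le_center :
    evenGrassmann n ≤ Subalgebra.toSubmodule (Subalgebra.center ℝ (Grassmann n)) := by
  set C := Subalgebra.toSubmodule (Subalgebra.center ℝ (Grassmann n)) with hC
  have hmul : C * C ≤ C := by
    rw [Submodule.mul_le]
    exact fun x hx y hy => (Subalgebra.center ℝ (Grassmann n)).mul_mem hx hy
  have h2 : LinearMap.range (ExteriorAlgebra.ι ℝ (M := Fin (2 * n) → ℝ)) ^ 2 ≤ C := by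
    rw [pow_two, Submodule.mul_le]
    rintro _ ⟨v, rfl⟩ _ ⟨w, rfl⟩
    have hswap : ∀ a b : Fin (2 * n) → ℝ,
        ExteriorAlgebra.ι ℝ a * ExteriorAlgebra.ι ℝ b
          = -(ExteriorAlgebra.ι ℝ b * ExteriorAlgebra.ι ℝ a) := fun a b =>
      eq_neg_of_add_eq_zero_left (ExteriorAlgebra.ι_add_mul_swap a b)
    change _ ∈ Subalgebra.center ℝ (Grassmann n)
    rw [Subalgebra.mem_center_iff]
    intro x
    induction x using ExteriorAlgebra.induction with
    | algebraMap r => exact Algebra.commutes r _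
    | ι z =>
      rw [← mul_assoc, hswap z v, neg_mul, mul_assoc, hswap z w, mul_neg, neg_neg, mul_assoc]
    | mul a b ha hb => rw [mul_assoc, hb, ← mul_assoc, ha, mul_assoc]
    | add a b ha hb => rw [add_mul, ha, hb, mul_add]
  have hpow : ∀ k : ℕ,
      (LinearMap.range (ExteriorAlgebra.ι ℝ (M := Fin (2 * n) → ℝ)) ^ 2) ^ k ≤ C := by
    intro k
    induction k with
    | zero =>
      rw [pow_zero, Submodule.one_le]
      exact (Subalgebra.center ℝ (Grassmann n)).one_mem
    | succ k ih =>
      rw [pow_succ]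
      exact (mul_le_mul' ih h2).trans hmul
  refine iSup_le fun ⟨j, hj⟩ => ?_
  obtain ⟨k, rfl⟩ := (ZMod.natCast_eq_zero_iff_even.1 hj).two_dvd
  change LinearMap.range (ExteriorAlgebra.ι ℝ (M := Fin (2 * n) → ℝ)) ^ (2 * k) ≤ C
  rw [pow_mul]
  exact hpow k

end Grassmann

/-! ### Even superfunctions -/

section Superfun

variable {m n : ℕ}

-- Shortcuts: these instances are found only slowly, or not at all, by unfolding `Superfun`.
instance : Ring (Superfun m n) := Algebra.TensorProduct.instRing

instance : AddCommGroup (Superfun m n) := TensorProduct.addCommGroup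

instance : AddCommGroup (Superdistr m n) := TensorProduct.addCommGroup

/-- The superfunctions with coefficients in the subspace `p` of the Grassmann algebra. -/
def superfunIn (m : ℕ) (p : Submodule ℝ (Grassmann n)) : Submodule ℝ (Superfun m n) :=
  LinearMap.range (p.subtype.lTensor (SmoothFun m))

theorem tmul_mem_superfunIn {p : Submodule ℝ (Grassmann n)} (f : SmoothFun m) {a : Grassmann n}
    (ha : a ∈ p) : f ⊗ₜ[ℝ] a ∈ superfunIn m p :=
  ⟨f ⊗ₜ ⟨a, ha⟩, rfl⟩

theorem superfunIn_le {p : Submodule ℝ (Grassmann n)} {N : Submodule ℝ (Superfun m n)}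
    (h : ∀ (f : SmoothFun m), ∀ a ∈ p, f ⊗ₜ[ℝ] a ∈ N) : superfunIn m p ≤ N := by
  rintro _ ⟨t, rfl⟩
  induction t using TensorProduct.induction_on with
  | zero => rw [map_zero]; exact N.zero_mem
  | tmul f a => exact h f a a.2
  | add s t hs ht => rw [map_add]; exact N.add_mem hs ht

theorem superfunIn_mono {p q : Submodule ℝ (Grassmann n)} (h : p ≤ q) :
    superfunIn m p ≤ superfunIn m q :=
  superfunIn_le fun f _ ha => tmul_mem_superfunIn f (h ha)

theorem mul_mem_superfunIn {p q : Submodule ℝ (Grassmann n)} {F G : Superfun m n}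
    (hF : F ∈ superfunIn m p) (hG : G ∈ superfunIn m q) : F * G ∈ superfunIn m (p * q) := by
  have h1 : superfunIn m p ≤ (superfunIn m (p * q)).comap (LinearMap.mulRight ℝ G) := by
    refine superfunIn_le fun f a ha => ?_
    have h2 : superfunIn m q ≤
        (superfunIn m (p * q)).comap (LinearMap.mulLeft ℝ (f ⊗ₜ[ℝ] a)) := by
      refine superfunIn_le fun f' b hb => ?_
      change f ⊗ₜ[ℝ] a * f' ⊗ₜ[ℝ] b ∈ superfunIn m (p * q)
      rw [Algebra.TensorProduct.tmul_mul_tmul]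
      exact tmul_mem_superfunIn _ (Submodule.mul_mem_mul ha hb)
    exact h2 hG
  exact h1 hF

theorem IsEven.mul {F G : Superfun m n} (hF : IsEven F) (hG : IsEven G) : IsEven (F * G) :=
  superfunIn_mono (CliffordAlgebra.evenOdd_mul_le (0 : QuadraticForm ℝ (Fin (2 * n) → ℝ)) 0 0)
    (mul_mem_superfunIn hF hG)

theorem isEven_tmul_one (f : SmoothFun m) : IsEven (f ⊗ₜ[ℝ] (1 : Grassmann n)) :=
  tmul_mem_superfunIn f ((CliffordAlgebra.one_le_evenOdd_zero _) (Submodule.one_le.1 le_rfl))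

theorem IsEven.nilp {F : Superfun m n} (hF : IsEven F) : IsEven (nilp F) :=
  (superfunIn m (evenGrassmann n)).sub_mem hF (isEven_tmul_one _)

theorem IsEven.neg {F : Superfun m n} (hF : IsEven F) : IsEven (-F) :=
  (superfunIn m (evenGrassmann n)).neg_mem hF

theorem IsEven.mem_center {F : Superfun m n} (hF : IsEven F) :
    F ∈ Subalgebra.center ℝ (Superfun m n) := by
  have h : superfunIn m (evenGrassmann n) ≤
      Subalgebra.toSubmodule (Subalgebra.center ℝ (Superfun m n)) := by
    refine superfunIn_le fun f a ha => ?_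
    change (f ⊗ₜ[ℝ] a : Superfun m n) ∈ Subalgebra.center ℝ (Superfun m n)
    have hac := (Subalgebra.mem_center_iff (R := ℝ)).1 (evenGrassmann_le_center ha)
    rw [Subalgebra.mem_center_iff]
    intro G
    induction G using TensorProduct.induction_on with
    | zero => simp
    | tmul f' b =>
      rw [Algebra.TensorProduct.tmul_mul_tmul, Algebra.TensorProduct.tmul_mul_tmul,
        mul_comm f' f]
      exact congrArg (fun c : Grassmann n => (f * f') ⊗ₜ[ℝ] c) (hac b)
    | add s t hs ht => rw [add_mul, mul_add, hs, ht]
  exact h hF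

theorem body_tmul (f : SmoothFun m) (a : Grassmann n) :
    body (f ⊗ₜ[ℝ] a : Superfun m n) = ExteriorAlgebra.algebraMapInv a • f := by
  simp [body]

theorem IsEven.nilp_mem {F : Superfun m n} (hF : IsEven F) :
    Superspace.nilp F ∈ superfunIn m (degreeGE n 2) := by
  let L : Superfun m n →ₗ[ℝ] Superfun m n := LinearMap.id -
    ((TensorProduct.mk ℝ (SmoothFun m) (Grassmann n)).flip 1) ∘ₗ body.toLinearMap
  have h : superfunIn m (evenGrassmann n) ≤ (superfunIn m (degreeGE n 2)).comap L := by
    refine superfunIn_le fun f a ha => ?_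
    have : L (f ⊗ₜ[ℝ] a) =
        f ⊗ₜ[ℝ] (a - algebraMap ℝ _ (ExteriorAlgebra.algebraMapInv a)) := by
      change f ⊗ₜ[ℝ] a - body (f ⊗ₜ[ℝ] a : Superfun m n) ⊗ₜ[ℝ] (1 : Grassmann n) = _
      rw [body_tmul, TensorProduct.tmul_sub, Algebra.algebraMap_eq_smul_one,
        TensorProduct.smul_tmul]
    rw [Submodule.mem_comap, this]
    exact tmul_mem_superfunIn f (sub_algebraMapInv_mem_degreeGE ha)
  exact h hF

/-- The nilpotent part of an even superfunction has nilpotency order at most `n + 1`, since there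
are only `2n` generators. -/
theorem IsEven.nilp_pow_eq_zero {F : Superfun m n} (hF : IsEven F) :
    Superspace.nilp F ^ (n + 1) = 0 := by
  have h : ∀ k : ℕ, Superspace.nilp F ^ (k + 1) ∈ superfunIn m (degreeGE n (2 * (k + 1))) := by
    intro k
    induction k with
    | zero => simpa using hF.nilp_mem
    | succ k ih =>
      rw [pow_succ]
      exact superfunIn_mono (degreeGE_mul_le _ _) (mul_mem_superfunIn ih hF.nilp_mem)
  have h0 : superfunIn m (degreeGE n (2 * (n + 1))) ≤ ⊥ := by
    rw [degreeGE_eq_bot (by omega)]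
    refine superfunIn_le fun f a ha => ?_
    rw [(Submodule.mem_bot ℝ).1 ha, TensorProduct.tmul_zero]
    exact (⊥ : Submodule ℝ (Superfun m n)).zero_mem
  exact (Submodule.mem_bot ℝ).1 (h0 (h n))

end Superfun

/-! ### The Taylor expansion identity -/

theorem one_sub_mul_sum_choose {R : Type*} [CommRing R] (x : R) (b M : ℕ) :
    (1 - x) * ∑ c ∈ Finset.range M, ((b + 1 + c).choose (b + 1) : R) * x ^ c =
      ∑ c ∈ Finset.range M, ((b + c).choose b : R) * x ^ c
        - ((b + M).choose (b + 1) : R) * x ^ M := by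
  induction M with
  | zero => simp
  | succ M ih =>
    rw [Finset.sum_range_succ, Finset.sum_range_succ, mul_add, ih,
      show b + 1 + M = b + M + 1 by ring, show b + (M + 1) = b + M + 1 by ring,
      Nat.choose_succ_succ]
    push_cast
    ring

/-- The negative binomial series for a nilpotent element. -/
theorem one_add_pow_mul_sum_choose {R : Type*} [CommRing R] {η : R} {M : ℕ} (hη : η ^ M = 0)
    (b : ℕ) :
    (1 + η) ^ (b + 1) * ∑ c ∈ Finset.range M, ((b + c).choose b : R) * (-η) ^ c = 1 := by
  have hη' : (-η) ^ M = 0 := by rw [neg_pow, hη, mul_zero]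
  induction b with
  | zero =>
    have := mul_neg_geom_sum (-η) M
    rw [hη', sub_neg_eq_add, sub_zero] at this
    simpa using this
  | succ b ih =>
    have := one_sub_mul_sum_choose (-η) b M
    rw [hη', mul_zero, sub_zero, sub_neg_eq_add] at this
    rw [pow_succ, mul_assoc, this, ih]

section Taylor

variable {R M : Type*} [CommRing R] [Algebra ℝ R] [AddCommGroup M] [Module ℝ M]
  (ρ : R →ₐ[ℝ] Module.End ℝ M) {D : ℕ → M} {u : R}

theorem pow_act (hu : ∀ k, ρ u (D (k + 1)) = (-((k : ℝ) + 1)) • D k) (b c : ℕ) :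
    ρ (u ^ c) (D (b + c)) = ((-1) ^ c * (((b + c).factorial : ℝ) / b.factorial)) • D b := by
  induction c with
  | zero =>
    have : (b.factorial : ℝ) ≠ 0 := Nat.cast_ne_zero.2 b.factorial_ne_zero
    simp [this]
  | succ c ih =>
    rw [pow_succ, map_mul, Module.End.mul_apply, ← add_assoc, hu, map_smul, ih, smul_smul,
      Nat.factorial_succ]
    congr 1
    push_cast
    ring

theorem pow_succ_act_eq_zero (h0 : ρ u (D 0) = 0)
    (hu : ∀ k, ρ u (D (k + 1)) = (-((k : ℝ) + 1)) • D k) (j : ℕ) :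
    ρ (u ^ (j + 1)) (D j) = 0 := by
  have := pow_act ρ hu 0 j
  rw [zero_add] at this
  rw [pow_succ', map_mul, Module.End.mul_apply, this, map_smul, h0, smul_zero]

/-- If `u` acts on the sequence `D_k` as multiplication by `t` acts on the derivatives `δ^{(k)}` of
the Dirac distribution, then the series `∑_{j ≥ 1} p^j/j! D_{j-1}` in the nilpotent variable `p`
takes the same value at `a` and at `(1 + η) a + η u = (1 + η) (u + a) - u`: expand the powers of
the second argument, move the powers of `u` to the `D_k`, and sum a negative binomial series. -/
theorem sum_pow_act_eq {a η : R} {N : ℕ} (ha : a ^ (N + 1) = 0) (hη : η ^ (N + 1) = 0)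
    (h0 : ρ u (D 0) = 0) (hu : ∀ k, ρ u (D (k + 1)) = (-((k : ℝ) + 1)) • D k) :
    ∑ j ∈ Finset.range (2 * N + 1), (((j + 1).factorial : ℝ)⁻¹) •
        ρ (((1 + η) * a + η * u) ^ (j + 1)) (D j) =
      ∑ j ∈ Finset.range (2 * N + 1), (((j + 1).factorial : ℝ)⁻¹) • ρ (a ^ (j + 1)) (D j) := by
  let f : ℕ → ℕ → M := fun b c => (((b + 1).factorial : ℝ)⁻¹) •
    ρ (a ^ (b + 1) * ((1 + η) ^ (b + 1) * (((b + c).choose b : R) * (-η) ^ c))) (D b)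
  -- the terms of total degree `j + 1` are indexed by the exponent `b + 1` of `a`
  have hterm : ∀ j, (((j + 1).factorial : ℝ)⁻¹) • ρ (((1 + η) * a + η * u) ^ (j + 1)) (D j) =
      ∑ b ∈ Finset.range (j + 1), f b (j - b) := by
    intro j
    rw [add_pow, map_sum, LinearMap.sum_apply, Finset.sum_range_succ']
    -- the term without a factor `a`
    have hlast : ρ (((1 + η) * a) ^ 0 * (η * u) ^ (j + 1 - 0) * ((j + 1).choose 0 : R)) (D j)
        = 0 := by
      rw [pow_zero, one_mul, tsub_zero, Nat.choose_zero_right, Nat.cast_one, mul_one, mul_pow,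
        map_mul, Module.End.mul_apply, pow_succ_act_eq_zero ρ h0 hu, map_zero]
    rw [hlast, add_zero, Finset.smul_sum]
    refine Finset.sum_congr rfl fun b hb => ?_
    obtain ⟨c, rfl⟩ := Nat.exists_eq_add_of_le (Nat.lt_succ_iff.1 (Finset.mem_range.1 hb))
    have e1 : ((1 + η) * a) ^ (b + 1) * (η * u) ^ (b + c + 1 - (b + 1)) *
        ((b + c + 1).choose (b + 1) : R) = algebraMap ℝ R ((b + c + 1).choose (b + 1)) *
          (a ^ (b + 1) * ((1 + η) ^ (b + 1) * η ^ c)) * u ^ c := by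
      rw [show b + c + 1 - (b + 1) = c by omega, map_natCast, mul_pow, mul_pow]
      ring
    have e2 : a ^ (b + 1) * ((1 + η) ^ (b + 1) * (((b + c).choose b : R) * (-η) ^ c)) =
        algebraMap ℝ R ((b + c).choose b * (-1) ^ c) *
          (a ^ (b + 1) * ((1 + η) ^ (b + 1) * η ^ c)) := by
      rw [neg_pow, map_mul, map_natCast, map_pow, map_neg, map_one]
      ring
    simp only [f, add_tsub_cancel_left]
    rw [e1, e2, map_mul, Module.End.mul_apply, pow_act ρ hu, map_smul, ← Algebra.smul_def,
      ← Algebra.smul_def, map_smul, map_smul, LinearMap.smul_apply, LinearMap.smul_apply,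
      smul_smul, smul_smul, smul_smul]
    congr 1
    have h1 : ((b + c + 1).choose (b + 1) : ℝ) =
        (b + c + 1).factorial / ((b + 1).factorial * c.factorial) := by
      rw [Nat.cast_choose ℝ (by omega), show b + c + 1 - (b + 1) = c by omega]
    have h2 : ((b + c).choose b : ℝ) = (b + c).factorial / (b.factorial * c.factorial) := by
      rw [Nat.cast_choose ℝ (by omega), show b + c - b = c by omega]
    have h3 : ∀ k : ℕ, (k.factorial : ℝ) ≠ 0 := fun k => Nat.cast_ne_zero.2 k.factorial_ne_zero
    have := h3 (b + c + 1)
    have := h3 (b + 1)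
    have := h3 b
    have := h3 c
    rw [h1, h2]
    field_simp
  simp only [hterm]
  rw [Finset.sum_range_diag_flip]
  refine Finset.sum_congr rfl fun b _ => ?_
  simp only [f]
  rw [← Finset.smul_sum, ← LinearMap.sum_apply, ← map_sum, ← Finset.mul_sum, ← Finset.mul_sum]
  congr 3
  rcases le_or_gt (N + 1) (b + 1) with hb | hb
  · rw [pow_eq_zero_of_le hb ha, zero_mul]
  · rw [one_add_pow_mul_sum_choose (pow_eq_zero_of_le (by omega) hη), mul_one]

end Taylor

/-! ### The action of superfunctions on superdistributions -/

section Action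

variable {m n : ℕ}

theorem superMul_tmul (f : SmoothFun m) (a : Grassmann n) (T : Distr m) (b : Grassmann n) :
    superMul m n (f ⊗ₜ a) (T ⊗ₜ b) = smulDistr m f T ⊗ₜ (a * b) := rfl

theorem smulDistr_one (T : Distr m) : smulDistr m 1 T = T := by
  ext φ
  change T (mulTest 1 φ) = T φ
  rw [mulTest_eq_self fun _ _ => rfl]

theorem smulDistr_mul (f g : SmoothFun m) (T : Distr m) :
    smulDistr m (f * g) T = smulDistr m f (smulDistr m g T) := by
  ext φ
  change T (mulTest (f * g) φ) = T (mulTest g (mulTest f φ))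
  congr 1
  ext x
  exact (mul_assoc _ _ _).symm

theorem superMul_one (S : Superdistr m n) : superMul m n 1 S = S := by
  induction S using TensorProduct.induction_on with
  | zero => exact map_zero _
  | add S S' hS hS' => exact (map_add _ S S').trans (congrArg₂ (· + ·) hS hS')
  | tmul T c =>
    change superMul m n ((1 : SmoothFun m) ⊗ₜ (1 : Grassmann n)) (T ⊗ₜ c) = T ⊗ₜ c
    rw [superMul_tmul, smulDistr_one, one_mul]

theorem superMul_tmul_mul_tmul (f g : SmoothFun m) (a b : Grassmann n) (S : Superdistr m n) :
    superMul m n ((f * g) ⊗ₜ (a * b)) S = superMul m n (f ⊗ₜ a) (superMul m n (g ⊗ₜ b) S) := by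
  induction S using TensorProduct.induction_on with
  | zero => simp only [map_zero]
  | add S S' hS hS' => simp only [map_add, hS, hS']
  | tmul T c =>
    rw [superMul_tmul, superMul_tmul, superMul_tmul, smulDistr_mul, mul_assoc]

theorem superMul_mul (F G : Superfun m n) (S : Superdistr m n) :
    superMul m n (F * G) S = superMul m n F (superMul m n G S) := by
  induction F using TensorProduct.induction_on with
  | zero => simp only [zero_mul, map_zero, LinearMap.zero_apply]
  | add F F' hF hF' => simp only [add_mul, map_add, LinearMap.add_apply, hF, hF']
  | tmul f a =>
    induction G using TensorProduct.induction_on with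
    | zero => simp only [mul_zero, map_zero, LinearMap.zero_apply]
    | add G G' hG hG' => simp only [mul_add, map_add, LinearMap.add_apply, hG, hG']
    | tmul g b =>
      rw [Algebra.TensorProduct.tmul_mul_tmul]
      exact superMul_tmul_mul_tmul f g a b S

/-- Multiplication of superdistributions by superfunctions, as an algebra homomorphism. -/
def superAct (m n : ℕ) : Superfun m n →ₐ[ℝ] Module.End ℝ (Superdistr m n) :=
  AlgHom.ofLinearMap (superMul m n) (LinearMap.ext superMul_one)
    fun F G => LinearMap.ext (superMul_mul F G)

theorem superAct_apply (F : Superfun m n) (S : Superdistr m n) :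
    superAct m n F S = superMul m n F S := rfl

end Action

/-! ### Invariance of the Heaviside superdistribution -/

section Invariance

variable {m n : ℕ} {g h : Superfun m n}

theorem heaviside_eq_sum_range (hg : IsEven g) {N : ℕ} (hN : n ≤ N) :
    heaviside g = heavisideComp (body g : Space m → ℝ) ⊗ₜ[ℝ] (1 : Grassmann n) +
      ∑ j ∈ Finset.range N, (((j + 1).factorial : ℝ)⁻¹) • superAct m n (nilp g ^ (j + 1))
        (diracComp j (body g : Space m → ℝ) ⊗ₜ[ℝ] (1 : Grassmann n)) := by
  rw [heaviside]
  congr 1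
  rw [← Finset.Ico_add_one_right_eq_Icc, Finset.sum_Ico_eq_sum_range, Nat.add_sub_cancel,
    ← Finset.sum_subset (Finset.range_mono hN)]
  · refine Finset.sum_congr rfl fun j _ => ?_
    rw [add_comm 1 j, Nat.add_sub_cancel, superAct_apply]
  · intro j _ hj
    rw [Finset.mem_range, not_lt] at hj
    rw [pow_eq_zero_of_le (Nat.succ_le_succ hj) hg.nilp_pow_eq_zero, map_zero,
      LinearMap.zero_apply, smul_zero]

theorem IsPhase.mul (hg : IsPhase g) (hh : IsEven h)
    (hpos : ∀ x : Space m, 0 < (body h : Space m → ℝ) x) : IsPhase (h * g) := by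
  refine ⟨hh.mul hg.even, fun x hx => ?_⟩
  rw [map_mul] at hx ⊢
  have hx0 : (body g : Space m → ℝ) x = 0 := (mul_eq_zero_iff_left (hpos x).ne').1 hx
  change fderiv ℝ ((body h : Space m → ℝ) * (body g : Space m → ℝ)) x ≠ 0
  rw [fderiv_mul (differentiable_coe (body h) x) (differentiable_coe (body g) x), hx0, zero_smul,
    add_zero]
  exact smul_ne_zero (hpos x).ne' (hg.regular x hx0)

theorem body_neg (g : Superfun m n) : body (-g) = -body g := map_neg _ _

theorem IsPhase.neg (hg : IsPhase g) : IsPhase (-g) := by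
  refine ⟨hg.even.neg, fun x hx => ?_⟩
  rw [body_neg] at hx ⊢
  change fderiv ℝ (-(body g : Space m → ℝ)) x ≠ 0
  rw [fderiv_neg]
  exact neg_ne_zero.2 (hg.regular x (neg_eq_zero.1 hx))

theorem realDomain_mul (hpos : ∀ x : Space m, 0 < (body h : Space m → ℝ) x) :
    realDomain (h * g) = realDomain g := by
  ext x
  change (body (h * g) : Space m → ℝ) x < 0 ↔ (body g : Space m → ℝ) x < 0
  rw [map_mul]
  rw [← not_le, ← not_le]
  exact not_congr (mul_nonneg_iff_of_pos_left (hpos x))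

theorem existsUnique_isDiracComp (hg : IsPhase g) (k : ℕ) :
    ∃! T : Distr m, IsDiracComp k (body g : Space m → ℝ) T :=
  ⟨_, isDiracComp_diracComp hg.regular k,
    fun _ hT => hT.unique hg.regular (isDiracComp_diracComp hg.regular k)⟩

/-- The center of the algebra of superfunctions, a commutative algebra which contains the even
superfunctions. -/
abbrev superCenter (m n : ℕ) : Subalgebra ℝ (Superfun m n) := Subalgebra.center ℝ (Superfun m n)

theorem add_mul_add_sub_mul_eq {R : Type*} [CommRing R] (a b u : R) {k i : R} (h : k * i = 1) :
    (b + k) * (a + u) - k * u = ((1 + i * b) * a + i * b * u) * k := by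
  linear_combination (-(b * a) - b * u) * h

/-- With `η = 𝐡 / h₀`, the nilpotent part of `h g` is `h₀ ((1 + η) 𝐠 + η g₀)`. The powers of `h₀`
are absorbed by the homogeneity of the `δ^{(k)}`, and the remaining sum is the one of `g`. -/
theorem heaviside_mul (hg : IsPhase g) (hh : IsEven h)
    (hpos : ∀ x : Space m, 0 < (body h : Space m → ℝ) x) : heaviside (h * g) = heaviside g := by
  have hhg := hg.mul hh hpos
  have hregmul : ∀ x, ((body h * body g : SmoothFun m) : Space m → ℝ) x = 0 →
      fderiv ℝ ((body h * body g : SmoothFun m) : Space m → ℝ) x ≠ 0 := by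
    rw [← map_mul]
    exact hhg.regular
  rw [heaviside_eq_sum_range hhg.even (N := 2 * n + 1) (by omega),
    heaviside_eq_sum_range hg.even (N := 2 * n + 1) (by omega), map_mul, heavisideComp_mul hpos]
  congr 1
  let ρ : superCenter m n →ₐ[ℝ] Module.End ℝ (Superdistr m n) :=
    (superAct m n).comp (superCenter m n).val
  let inv : SmoothFun m := ⟨fun x => ((body h : Space m → ℝ) x)⁻¹,
    (contDiff_coe (body h)).inv fun x => (hpos x).ne'⟩
  have hinv : body h * inv = 1 := Subtype.ext (funext fun x => mul_inv_cancel₀ (hpos x).ne')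
  let ι : SmoothFun m → superCenter m n := fun f => ⟨f ⊗ₜ[ℝ] (1 : Grassmann n), (isEven_tmul_one f).mem_center⟩
  have hι_mul : ∀ f f', ι (f * f') = ι f * ι f' := fun f f' => Subtype.ext <| by
    change (f * f') ⊗ₜ[ℝ] (1 : Grassmann n) = f ⊗ₜ[ℝ] (1 : Grassmann n) * f' ⊗ₜ[ℝ] (1 : Grassmann n)
    rw [Algebra.TensorProduct.tmul_mul_tmul, one_mul]
  have hι_one : ι 1 = 1 := rfl
  have hι_pow : ∀ f j, ι (f ^ j) = ι f ^ j := fun f j => by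
    induction j with
    | zero => rw [pow_zero, pow_zero, hι_one]
    | succ j ih => rw [pow_succ, pow_succ, hι_mul, ih]
  let a : superCenter m n := ⟨nilp g, hg.even.nilp.mem_center⟩
  let b : superCenter m n := ⟨nilp h, hh.nilp.mem_center⟩
  let η : superCenter m n := ι inv * b
  have ha : a ^ (n + 1) = 0 := Subtype.ext hg.even.nilp_pow_eq_zero
  have hb : b ^ (n + 1) = 0 := Subtype.ext hh.nilp_pow_eq_zero
  have hη : η ^ (n + 1) = 0 := by rw [mul_pow, hb, mul_zero]
  let c : superCenter m n := ⟨nilp (h * g), hhg.even.nilp.mem_center⟩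
  have hc : c = ((1 + η) * a + η * ι (body g)) * ι (body h) := by
    have h1 : c = (b + ι (body h)) * (a + ι (body g)) - ι (body h) * ι (body g) := by
      rw [← hι_mul]
      refine Subtype.ext ?_
      change h * g - body (h * g) ⊗ₜ[ℝ] (1 : Grassmann n) =
        (h - body h ⊗ₜ[ℝ] (1 : Grassmann n) + body h ⊗ₜ[ℝ] (1 : Grassmann n)) *
          (g - body g ⊗ₜ[ℝ] (1 : Grassmann n) + body g ⊗ₜ[ℝ] (1 : Grassmann n)) -
            (body h * body g) ⊗ₜ[ℝ] (1 : Grassmann n)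
      rw [sub_add_cancel, sub_add_cancel, map_mul]
    have h2 : ι (body h) * ι inv = 1 := by rw [← hι_mul, hinv, hι_one]
    exact h1.trans (add_mul_add_sub_mul_eq a b (ι (body g)) h2)
  have hact : ∀ (f : SmoothFun m) (T : Distr m), ρ (ι f) (T ⊗ₜ[ℝ] (1 : Grassmann n)) =
      smulDistr m f T ⊗ₜ[ℝ] (1 : Grassmann n) := fun f T => by
    change superMul m n (f ⊗ₜ 1) (T ⊗ₜ 1) = _
    rw [superMul_tmul, one_mul]
  have hsum := sum_pow_act_eq ρ (u := ι (body g))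
    (D := fun j => diracComp j (body g : Space m → ℝ) ⊗ₜ[ℝ] (1 : Grassmann n)) ha hη
    (by rw [hact, smulDistr_diracComp_zero hg.regular, TensorProduct.zero_tmul])
    (fun k => by rw [hact, smulDistr_diracComp_succ hg.regular, TensorProduct.smul_tmul'])
  refine Eq.trans (Finset.sum_congr rfl fun j _ => ?_) hsum
  congr 1
  change ρ (c ^ (j + 1)) (diracComp j _ ⊗ₜ[ℝ] (1 : Grassmann n)) = _
  rw [hc, mul_pow, map_mul, Module.End.mul_apply, ← hι_pow, hact,
    smulDistr_pow_diracComp_mul hpos hg.regular hregmul]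

end Invariance

end Superspace

end

open Superspace
theorem proposition4 (m n : ℕ) (g h : Superfun m n) (hg : IsPhase g) (hh : IsEven h)
    (hpos : ∀ x : Space m, 0 < (body h : Space m → ℝ) x) :
    (IsPhase (h * g) ∧ realDomain (h * g) = realDomain g) ∧
    (∀ k : ℕ, (∃! T : Distr m, IsDiracComp k (body g : Space m → ℝ) T) ∧
      ∃! T : Distr m, IsDiracComp k (body (h * g) : Space m → ℝ) T) ∧
    heaviside (h * g) = heaviside g ∧
    (IsCompact (closure (realDomain g)) →
      ∀ F : Finset (Fin (2 * n)) → Space m → ℝ,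
        (∀ A, ContDiffOn ℝ ((n - 1 : ℕ) : ℕ∞) (F A) (closure (realDomain g))) →
          ∀ c : ℝ, HasDomainIntegral (h * g) F c ↔ HasDomainIntegral g F c) := by
  refine ⟨⟨hg.mul hh hpos, realDomain_mul hpos⟩, fun k => ⟨existsUnique_isDiracComp hg k,
    existsUnique_isDiracComp (hg.mul hh hpos) k⟩, heaviside_mul hg hh hpos, fun _ F _ c => ?_⟩
  have hneg : heaviside (-(h * g)) = heaviside (-g) := by
    rw [← mul_neg]
    exact heaviside_mul hg.neg hh hpos
  rw [HasDomainIntegral, HasDomainIntegral, realDomain_mul hpos, hneg]
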